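/- Consider sequences $f=(f_n)_{n\in\mathbb N}$ of Boolean functions $f_n\colon\{0,1\}^n\to\{0,1\}$. **Circuits.** $\mathsf{LOGCFL}/\mathsf{poly}$ (also known as $\mathsf{SAC}^1$) is the class of all $f$ for which there are Boolean circuits $C_n$ computing $f_n$ (for every $n$), with inputs labelled by variables or constants $0,1$, AND-gates with two inputs, OR-gates with arbitrarily many inputs, and NOT-gates applied only to inputs of the circuit, such that the number of gates of $C_n$ is bounded by a polynomial in $n$ and the depth of $C_n$ (the length of the longest directed path to the output gate) is $O(\log n)$. The class $\mathsf{mLOGCFL}/\mathsf{poly}$ is defined in the same way using monotone circuits, that is, circuits without NOT-gates. **Tree hypergraph programs.** A hypergraph program (HGP) $P$ over variables $p_1,\dots,p_n$ is a finite hypergraph $H=(V,E)$, $E\subseteq 2^V$, each of whose vertices is labelled by $0$, $1$, some $p_i$ or some $\neg p_i$; its size is $|V|+|E|$, and it is monotone if no label is a negated variable. For $\alpha\in\{0,1\}^n$, $P(\alpha)=1$ iff there is a set $E'\subseteq E$ of pairwise disjoint hyperedges such that every vertex whose label evaluates to $0$ under $\alpha$ belongs to some hyperedge in $E'$; $P$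 computes $f_n$ if $P(\alpha)=f_n(\alpha)$ for all $\alpha\in\{0,1\}^n$. The hypergraph $H$ is a tree hypergraph if there is a finite (undirected) tree $T$ such that $V$ is the set of edges of $T$ and, for each $e\in E$, the edges in $e$ together with their endpoints form a subtree $T_e$ of $T$ that is convex: for every vertex $u$ of $T_e$ whose degree in $T_e$ is not $1$, all edges of $T$ incident to $u$ belong to $T_e$. A tree hypergraph program (THGP) is an HGP based on a tree hypergraph. $\mathsf{THGP}$ (respectively, $\mathsf{mTHGP}$) is the class of all $f$ for which there are THGPs (respectively, monotone THGPs) $P_n$ computing $f_n$ for every $n$, with $|P_n|$ bounded by a polynomial in $n$. **Theorem.** $\mathsf{LOGCFL}/\mathsf{poly}=\mathsf{THGP}$ and $\mathsf{mLOGCFL}/\mathsf{poly}=\mathsf{mTHGP}$. -/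

import Mathlib

namespace TreeHP

/-- A sequence `f = (f_n)` of Boolean functions, one of each arity `n`. -/
abbrev BoolFunSeq : Type := (n : ℕ) → (Fin n → Bool) → Bool

/-- `s n` is bounded by a polynomial in `n`. -/
def PolyBounded (s : ℕ → ℕ) : Prop :=
  ∃ p : Polynomial ℕ, ∀ n, s n ≤ p.eval n

/-! ### Circuits -/

/-- The label of a gate over the variables `p_i`, `i : Fin n`, together with the gates (elements
of `G`) from which it gets its inputs. AND-gates have two inputs, OR-gates have arbitrarily many
inputs (an OR-gate without inputs has value `0`). -/
inductive Gate (n : ℕ) (G : Type) : Type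
  | const (b : Bool) : Gate n G
  | var (i : Fin n) : Gate n G
  | not (a : G) : Gate n G
  | and (a b : G) : Gate n G
  | or (s : Finset G) : Gate n G

/-- The gates that feed a gate. -/
def Gate.inputs {n : ℕ} {G : Type} : Gate n G → Set G
  | .const _ => ∅
  | .var _ => ∅
  | .not a => {a}
  | .and a b => {a, b}
  | .or s => ↑s

/-- The input gates are those labelled with a constant or a variable. -/
def Gate.IsInput {n : ℕ} {G : Type} : Gate n G → Prop
  | .const _ => True
  | .var _ => True
  | _ => False

open Classical in
/-- The value of a gate under the assignment `α`, given the values of the gates that feed it. -/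
noncomputable def Gate.eval {n : ℕ} {G : Type} (α : Fin n → Bool) :
    (g : Gate n G) → ((a : G) → a ∈ g.inputs → Bool) → Bool
  | .const b, _ => b
  | .var i, _ => α i
  | .not a, v => !(v a (Set.mem_singleton a))
  | .and a b, v => v a (Set.mem_insert a {b}) && v b (Set.mem_insert_of_mem a rfl)
  | .or s, v => decide (∃ (a : G) (h : a ∈ s), v a (Finset.mem_coe.mpr h) = true)

/-- A Boolean circuit in `n` variables with AND-gates of fan-in 2 and OR-gates of unbounded fan-in:
a finite directed acyclic graph of gates with a distinguished output gate. (For a finite graph,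
being acyclic is the same as well-foundedness of the wire relation.) -/
structure Circuit (n : ℕ) where
  G : Type
  [fintypeG : Fintype G]
  gate : G → Gate n G
  acyclic : WellFounded fun a b : G => a ∈ (gate b).inputs
  output : G

attribute [instance] Circuit.fintypeG

namespace Circuit

variable {n : ℕ}

/-- There is a wire from gate `a` to gate `b`. -/
def Wire (C : Circuit n) (a b : C.G) : Prop := a ∈ (C.gate b).inputs

/-- The value of a gate of the circuit under the assignment `α`. -/
noncomputable def value (C : Circuit n) (α : Fin n → Bool) : C.G → Bool :=
  C.acyclic.fix fun g v => (C.gate g).eval α v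

/-- `C` computes the `n`-ary Boolean function `f`. -/
def Computes (C : Circuit n) (f : (Fin n → Bool) → Bool) : Prop :=
  ∀ α, C.value α C.output = f α

/-- The size of a circuit is its number of gates. -/
def size (C : Circuit n) : ℕ := Fintype.card C.G

/-- `C.Path a b k`: there is a directed path of length `k` from gate `a` to gate `b`. -/
inductive Path (C : Circuit n) : C.G → C.G → ℕ → Prop
  | refl (a : C.G) : Path C a a 0
  | step {a b c : C.G} {k : ℕ} : Path C a b k → C.Wire b c → Path C a c (k + 1)

/-- The depth is at most `d`: every directed path to the output gate has length at most `d`. -/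
def DepthLE (C : Circuit n) (d : ℕ) : Prop :=
  ∀ a k, C.Path a C.output k → k ≤ d

/-- NOT-gates are only applied to input gates. -/
def NotOnlyOnInputs (C : Circuit n) : Prop :=
  ∀ g a, C.gate g = Gate.not a → (C.gate a).IsInput

/-- A monotone circuit has no NOT-gates at all. -/
def IsMonotone (C : Circuit n) : Prop :=
  ∀ g a, C.gate g ≠ Gate.not a

end Circuit

/-- `LOGCFL/poly` (also known as `SAC¹`): the sequences of Boolean functions computed by sequences
of circuits of polynomial size and depth `O(log n)`, with AND-gates of fan-in 2, OR-gates of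
unbounded fan-in, and NOT-gates only on inputs. The `+ 1` only matters for `n ≤ 1`. -/
def LOGCFLpoly : Set BoolFunSeq :=
  {f | ∃ C : (n : ℕ) → Circuit n,
    (∀ n, (C n).NotOnlyOnInputs) ∧
    (∀ n, (C n).Computes (f n)) ∧
    PolyBounded (fun n => (C n).size) ∧
    ∃ c : ℕ, ∀ n, (C n).DepthLE (c * (Nat.log 2 n + 1))}

/-- `mLOGCFL/poly`: the same class with monotone circuits. -/
def mLOGCFLpoly : Set BoolFunSeq :=
  {f | ∃ C : (n : ℕ) → Circuit n,
    (∀ n, (C n).IsMonotone) ∧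
    (∀ n, (C n).Computes (f n)) ∧
    PolyBounded (fun n => (C n).size) ∧
    ∃ c : ℕ, ∀ n, (C n).DepthLE (c * (Nat.log 2 n + 1))}

/-! ### Hypergraph programs -/

/-- Vertex labels of hypergraph programs: `0`, `1`, a variable or a negated variable. -/
inductive VLabel (n : ℕ) : Type
  | const (b : Bool) : VLabel n
  | var (i : Fin n) : VLabel n
  | negVar (i : Fin n) : VLabel n

/-- The value of a label under the assignment `α`. -/
def VLabel.eval {n : ℕ} (α : Fin n → Bool) : VLabel n → Bool
  | .const b => b
  | .var i => α i
  | .negVar i => !(α i)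

/-- A hypergraph program over `n` variables: a finite hypergraph `(V, E)` whose vertices are
labelled by `0`, `1` or literals. -/
structure HGP (n : ℕ) where
  V : Type
  [fintypeV : Fintype V]
  E : Finset (Finset V)
  label : V → VLabel n

attribute [instance] HGP.fintypeV

namespace HGP

variable {n : ℕ}

/-- The output of `P` on `α` is `1`: some independent (pairwise disjoint) set of hyperedges covers
every vertex whose label evaluates to `0`. -/
def Accepts (P : HGP n) (α : Fin n → Bool) : Prop :=
  ∃ E' ⊆ P.E, (∀ e ∈ E', ∀ e' ∈ E', e ≠ e' → Disjoint e e') ∧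
    ∀ v, (P.label v).eval α = false → ∃ e ∈ E', v ∈ e

/-- `P` computes the `n`-ary Boolean function `f`. -/
def Computes (P : HGP n) (f : (Fin n → Bool) → Bool) : Prop :=
  ∀ α, f α = true ↔ P.Accepts α

/-- The size of the underlying hypergraph, `|V| + |E|`. -/
def size (P : HGP n) : ℕ := Fintype.card P.V + P.E.card

/-- No vertex is labelled by a negated variable. -/
def IsMonotone (P : HGP n) : Prop :=
  ∀ v i, P.label v ≠ VLabel.negVar i

end HGP

/-! ### Tree hypergraphs -/

/-- The subgraph of `T` formed by a set `S` of edges of `T` and their endpoints. -/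
def inducedByEdges {W : Type} (T : SimpleGraph W) (S : Set T.edgeSet) : T.Subgraph where
  verts := {w | ∃ s ∈ S, w ∈ (s : Sym2 W)}
  Adj u v := ∃ s ∈ S, (s : Sym2 W) = s(u, v)
  adj_sub := by
    rintro u v ⟨s, -, hs⟩
    have h := s.2
    rwa [hs] at h
  edge_vert := by
    rintro u v ⟨s, hS, hs⟩
    exact ⟨s, hS, hs ▸ Sym2.mem_mk_left u v⟩
  symm := ⟨by
    rintro u v ⟨s, hS, hs⟩
    exact ⟨s, hS, hs.trans Sym2.eq_swap⟩⟩

/-- A leaf of the subgraph `T'` is a vertex of degree 1 in `T'`. -/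
def IsLeaf {W : Type} {T : SimpleGraph W} (T' : T.Subgraph) (u : W) : Prop :=
  u ∈ T'.verts ∧ (T'.neighborSet u).ncard = 1

/-- `T'` is a convex subtree of `T`: it is a tree, and with any of its non-leaf vertices `u` it
contains all edges of `T` incident to `u`. -/
def IsConvexSubtree {W : Type} {T : SimpleGraph W} (T' : T.Subgraph) : Prop :=
  T'.coe.IsTree ∧ ∀ u ∈ T'.verts, ¬ IsLeaf T' u → ∀ v, T.Adj u v → T'.Adj u v

/-- `(V, E)` is a tree hypergraph: there is a finite tree `T` whose edges are (identified by `φ`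
with) the elements of `V`, such that every hyperedge induces a convex subtree of `T`. -/
def IsTreeHypergraph {V : Type} (E : Finset (Finset V)) : Prop :=
  ∃ (W : Type) (_ : Finite W) (T : SimpleGraph W) (φ : V ≃ T.edgeSet), T.IsTree ∧
    ∀ e ∈ E, IsConvexSubtree (inducedByEdges T (φ '' (e : Set V)))

/-- A tree hypergraph program is a hypergraph program based on a tree hypergraph. -/
def HGP.IsTHGP {n : ℕ} (P : HGP n) : Prop := IsTreeHypergraph P.E

/-- The sequences of Boolean functions computed by sequences of polynomial-size THGPs. -/
def THGP : Set BoolFunSeq :=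
  {f | ∃ P : (n : ℕ) → HGP n,
    (∀ n, (P n).IsTHGP) ∧
    (∀ n, (P n).Computes (f n)) ∧
    PolyBounded (fun n => (P n).size)}

/-- The sequences of Boolean functions computed by sequences of polynomial-size monotone THGPs. -/
def mTHGP : Set BoolFunSeq :=
  {f | ∃ P : (n : ℕ) → HGP n,
    (∀ n, (P n).IsTHGP) ∧
    (∀ n, (P n).IsMonotone) ∧
    (∀ n, (P n).Computes (f n)) ∧
    PolyBounded (fun n => (P n).size)}

end TreeHP

/-!
Both simulations pass through finite systems of inference rules with two premises, in which only
the labels of the axioms depend on the input (`InferenceSystem`).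

*From circuits to tree hypergraph programs.* The true gates of a circuit of depth `d` are those
derivable by a complete binary tree of depth `d` (`Circuit.derivableInDepth_goal_iff`). If `d` is
logarithmic, this tree has polynomial size and can be built into the program: each node hangs from
its parent by a long path, and the choice of an item for a node is encoded by the place at which
this path is divided between a hyperedge around the parent and a hyperedge around the node. The
hyperedges around a node correspond to the rules. An independent cover must divide every path at
exactly one place, so both ends agree on the item (`InferenceSystem.derivableInDepth_of_cover`),
and above a leaf the edge left uncovered at this place carries the label of the axiom.

*From tree hypergraph programs to circuits.* If the tree is rooted at a leaf, convexity forces each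
hyperedge to have a unique topmost edge (`IsTreeHypergraph.exists_par`). Hence an independent set of
hyperedges can be guessed from the root downwards: once the piece (hyperedge or uncovered edge) that
contains an edge is known, the pieces below it are independent of one another. This gives an
inference system of polynomial size in which acceptance is witnessed by derivations of polynomial
size (`HGP.accepts_of_derivable`, `HGP.exists_derivable_of_accepts`). Derivations of size `2 ^ k`,
whatever their shape, are found by a search of depth `O(k)` that repeatedly cuts derivation trees
into parts of half the size (`InferenceSystem.derivableInStage_of_le_two_pow`). A step of the search
is a disjunction of conjunctions with three members, hence two layers of AND-gates of fan-in two
below OR-gates of unbounded fan-in.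

Negations occur only in labels of axioms and are passed on unchanged, so monotone circuits and
monotone programs correspond to each other.
-/

namespace TreeHP

/-! ### Polynomial bounds and logarithms -/

/-- Polynomial bounds are the bounds of the form `2 ^ O(log n)`. -/
theorem polyBounded_iff_exists_le_two_pow (s : ℕ → ℕ) :
    PolyBounded s ↔ ∃ c : ℕ, ∀ n, s n ≤ 2 ^ (c * (Nat.log 2 n + 1)) := by
  constructor
  · rintro ⟨p, hp⟩
    suffices h : ∃ c : ℕ, ∀ n, p.eval n ≤ 2 ^ (c * (Nat.log 2 n + 1)) from
      h.imp fun c hc n => (hp n).trans (hc n)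
    clear hp
    induction p using Polynomial.induction_on' with
    | add p q hp hq =>
      obtain ⟨c, hc⟩ := hp
      obtain ⟨d, hd⟩ := hq
      refine ⟨c + d + 1, fun n => ?_⟩
      rw [Polynomial.eval_add]
      have h1 : 2 ^ (c * (Nat.log 2 n + 1)) ≤ 2 ^ ((c + d) * (Nat.log 2 n + 1)) :=
        Nat.pow_le_pow_right (by norm_num) (Nat.mul_le_mul_right _ (Nat.le_add_right _ _))
      have h2 : 2 ^ (d * (Nat.log 2 n + 1)) ≤ 2 ^ ((c + d) * (Nat.log 2 n + 1)) :=
        Nat.pow_le_pow_right (by norm_num) (Nat.mul_le_mul_right _ (Nat.le_add_left _ _))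
      have h3 : 2 ^ ((c + d) * (Nat.log 2 n + 1) + 1) ≤ 2 ^ ((c + d + 1) * (Nat.log 2 n + 1)) :=
        Nat.pow_le_pow_right (by norm_num) (by ring_nf; omega)
      rw [pow_succ] at h3
      have := hc n
      have := hd n
      omega
    | monomial k a =>
      refine ⟨a + k, fun n => ?_⟩
      rw [Polynomial.eval_monomial, add_mul, pow_add]
      refine Nat.mul_le_mul ?_ ?_
      · exact (Nat.lt_two_pow_self).le.trans
          (Nat.pow_le_pow_right (by norm_num) (Nat.le_mul_of_pos_right _ (Nat.succ_pos _)))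
      · rw [mul_comm, pow_mul]
        exact Nat.pow_le_pow_left (Nat.lt_pow_succ_log_self (by norm_num) n).le k
  · rintro ⟨c, hc⟩
    refine ⟨(2 * (Polynomial.X + 1)) ^ c, fun n => (hc n).trans ?_⟩
    rw [mul_comm, pow_mul, Polynomial.eval_pow]
    refine Nat.pow_le_pow_left ?_ c
    simp only [Polynomial.eval_mul, Polynomial.eval_add, Polynomial.eval_X, Polynomial.eval_one,
      Polynomial.eval_ofNat]
    rw [pow_succ, mul_comm]
    refine Nat.mul_le_mul_left _ ?_
    rcases Nat.eq_zero_or_pos n with rfl | hn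
    · simp
    · exact (Nat.pow_log_le_self 2 hn.ne').trans (Nat.le_succ n)

/-! ### Evaluation of circuits -/

namespace Circuit

variable {n : ℕ} (C : Circuit n) (α : Fin n → Bool)

theorem value_eq (g : C.G) : C.value α g = (C.gate g).eval α fun a _ => C.value α a :=
  WellFounded.fix_eq _ _ _

variable {C} {g : C.G}

theorem value_const {b : Bool} (h : C.gate g = .const b) : C.value α g = b := by
  rw [value_eq, h]; rfl

theorem value_var {i : Fin n} (h : C.gate g = .var i) : C.value α g = α i := by
  rw [value_eq, h]; rfl

theorem value_not {a : C.G} (h : C.gate g = .not a) : C.value α g = !(C.value α a) := by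
  rw [value_eq, h]; rfl

theorem value_and {a b : C.G} (h : C.gate g = .and a b) :
    C.value α g = (C.value α a && C.value α b) := by
  rw [value_eq, h]; rfl

theorem value_or {s : Finset C.G} (h : C.gate g = .or s) :
    C.value α g = true ↔ ∃ a ∈ s, C.value α a = true := by
  rw [value_eq, h]; simp [Gate.eval]

end Circuit

/-! ### Inference systems -/

/-- A finite system of inference rules with two premises. An item `x` is derivable under an
assignment if its label `ax x` is true, or if it follows by a rule `rule x y z` from derivable
items `y` and `z`. Neither the items nor the rules depend on the assignment. -/
structure InferenceSystem (n : ℕ) where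
  Item : Type
  [fintypeItem : Fintype Item]
  rule : Item → Item → Item → Prop
  ax : Item → VLabel n
  goal : Item

attribute [instance] InferenceSystem.fintypeItem

namespace InferenceSystem

variable {n : ℕ} (S : InferenceSystem n) (α : Fin n → Bool)

/-- No axiom is a negated variable. -/
def IsMonotone : Prop := ∀ x i, S.ax x ≠ .negVar i

/-- `x` is the root of a derivation that is a complete binary tree of depth `k`. -/
def DerivableInDepth : ℕ → S.Item → Prop
  | 0, x => (S.ax x).eval α = true
  | k + 1, x => ∃ y z, S.rule x y z ∧ DerivableInDepth k y ∧ DerivableInDepth k z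

end InferenceSystem

/-! ### Circuits as inference systems -/

namespace Circuit

variable {n : ℕ} (C : Circuit n)

/-- The literal or constant that an input gate, or a NOT-gate on an input gate, stands for. The
gates of the other kinds get the label `0`. -/
def gateLabel (g : C.G) : VLabel n :=
  match C.gate g with
  | .const b => .const b
  | .var i => .var i
  | .not a =>
    match C.gate a with
    | .const b => .const (!b)
    | .var i => .negVar i
    | _ => .const false
  | _ => .const false

/-- The rules that derive the true gates of a circuit. The item `none` is always derivable; it
serves as an idle second premise and, for literals, pads derivations to a prescribed depth. -/
def gateRule : Option C.G → Option C.G → Option C.G → Prop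
  | none, y, z => y = none ∧ z = none
  | some g, y, z =>
    match C.gate g with
    | .and a b => y = some a ∧ z = some b
    | .or s => (∃ a ∈ s, y = some a) ∧ z = none
    | _ => y = some g ∧ z = none

/-- The inference system whose derivable items are the true gates of a circuit. -/
def toInferenceSystem : InferenceSystem n where
  Item := Option C.G
  rule := C.gateRule
  ax x := x.elim (.const true) C.gateLabel
  goal := some C.output

variable {C}

theorem IsMonotone.toInferenceSystem (hC : C.IsMonotone) : C.toInferenceSystem.IsMonotone := by
  rintro (_ | g) i h
  · simp [Circuit.toInferenceSystem] at h
  · simp only [Circuit.toInferenceSystem, Option.elim_some, gateLabel] at h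
    cases hg : C.gate g with
    | not a => exact hC g a hg
    | _ => simp [hg] at h

theorem IsMonotone.notOnlyOnInputs (hC : C.IsMonotone) : C.NotOnlyOnInputs :=
  fun g a h => absurd h (hC g a)

theorem derivableInDepth_none (α : Fin n → Bool) (k : ℕ) :
    C.toInferenceSystem.DerivableInDepth α k none := by
  induction k with
  | zero => rfl
  | succ k ih => exact ⟨none, none, ⟨rfl, rfl⟩, ih, ih⟩

theorem eval_gateLabel_imp_value (α : Fin n → Bool) {g : C.G}
    (h : (C.gateLabel g).eval α = true) : C.value α g = true := by
  unfold gateLabel at h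
  cases hg : C.gate g with
  | const b => rw [hg] at h; rw [value_const α hg]; exact h
  | var i => rw [hg] at h; rw [value_var α hg]; exact h
  | not a =>
    rw [hg] at h
    rw [value_not α hg]
    cases ha : C.gate a with
    | const b => simp only [ha] at h; rw [value_const α ha]; exact h
    | var i => simp only [ha] at h; rw [value_var α ha]; exact h
    | _ => simp [ha, VLabel.eval] at h
  | _ => simp [hg, VLabel.eval] at h

theorem value_of_derivableInDepth (α : Fin n → Bool) (k : ℕ) (g : C.G)
    (h : C.toInferenceSystem.DerivableInDepth α k (some g)) : C.value α g = true := by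
  induction k generalizing g with
  | zero => exact eval_gateLabel_imp_value α h
  | succ k ih =>
    obtain ⟨y, z, hr, hy, hz⟩ := h
    simp only [toInferenceSystem, gateRule] at hr
    cases hg : C.gate g with
    | and a b =>
      rw [hg] at hr
      obtain ⟨rfl, rfl⟩ := hr
      rw [value_and α hg, ih a hy, ih b hz]; rfl
    | or s =>
      rw [hg] at hr
      obtain ⟨⟨a, ha, rfl⟩, -⟩ := hr
      exact (value_or α hg).2 ⟨a, ha, ih a hy⟩
    | _ =>
      rw [hg] at hr
      obtain ⟨rfl, -⟩ := hr
      exact ih g hy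

theorem derivableInDepth_of_eval_gateLabel (α : Fin n → Bool) (k : ℕ) {g : C.G}
    (h : (C.gateLabel g).eval α = true)
    (hg : C.gateRule (some g) (some g) none) :
    C.toInferenceSystem.DerivableInDepth α k (some g) := by
  induction k with
  | zero => exact h
  | succ k ih => exact ⟨some g, none, hg, ih, derivableInDepth_none α k⟩

theorem derivableInDepth_of_value (hC : C.NotOnlyOnInputs) (α : Fin n → Bool) (k : ℕ) (g : C.G)
    (hk : ∀ a j, C.Path a g j → j ≤ k) (h : C.value α g = true) :
    C.toInferenceSystem.DerivableInDepth α k (some g) := by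
  induction k generalizing g with
  | zero =>
    have hin : ∀ a, a ∉ (C.gate g).inputs := fun a ha => by
      simpa using hk a 1 (.step (.refl a) ha)
    change (C.gateLabel g).eval α = true
    unfold gateLabel
    cases hg : C.gate g with
    | const b => rwa [value_const α hg] at h
    | var i => rwa [value_var α hg] at h
    | not a => exact absurd (by rw [hg]; exact rfl) (hin a)
    | and a b => exact absurd (by rw [hg]; exact Or.inl rfl) (hin a)
    | or s =>
      obtain ⟨a, ha, -⟩ := (value_or α hg).1 h
      exact absurd (by rw [hg]; exact Finset.mem_coe.2 ha) (hin a)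
  | succ k ih =>
    have step : ∀ a, a ∈ (C.gate g).inputs → C.value α a = true →
        C.toInferenceSystem.DerivableInDepth α k (some a) := fun a ha hv =>
      ih a (fun b j hp => Nat.le_of_succ_le_succ (hk b (j + 1) (.step hp ha))) hv
    cases hg : C.gate g with
    | and a b =>
      rw [value_and α hg, Bool.and_eq_true] at h
      exact ⟨some a, some b, by simp [toInferenceSystem, gateRule, hg],
        step a (by rw [hg]; exact Or.inl rfl) h.1, step b (by rw [hg]; exact Or.inr rfl) h.2⟩
    | or s =>
      obtain ⟨a, ha, hv⟩ := (value_or α hg).1 h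
      exact ⟨some a, none, by simp [toInferenceSystem, gateRule, hg, ha],
        step a (by rw [hg]; exact Finset.mem_coe.2 ha) hv, derivableInDepth_none α k⟩
    | const b =>
      refine derivableInDepth_of_eval_gateLabel α _ ?_ (by simp [gateRule, hg])
      simpa [gateLabel, hg, VLabel.eval, value_const α hg] using h
    | var i =>
      refine derivableInDepth_of_eval_gateLabel α _ ?_ (by simp [gateRule, hg])
      simpa [gateLabel, hg, VLabel.eval, value_var α hg] using h
    | not a =>
      refine derivableInDepth_of_eval_gateLabel α _ ?_ (by simp [gateRule, hg])
      have ha := hC g a hg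
      rw [value_not α hg] at h
      cases hga : C.gate a with
      | const b => simpa [gateLabel, hg, hga, VLabel.eval, value_const α hga] using h
      | var i => simpa [gateLabel, hg, hga, VLabel.eval, value_var α hga] using h
      | _ => simp [hga, Gate.IsInput] at ha

/-- The value of a circuit of depth at most `d`, as derivability by complete trees of depth `d`. -/
theorem derivableInDepth_goal_iff (hC : C.NotOnlyOnInputs) {d : ℕ} (hd : C.DepthLE d)
    (α : Fin n → Bool) :
    C.toInferenceSystem.DerivableInDepth α d C.toInferenceSystem.goal ↔
      C.value α C.output = true :=
  ⟨value_of_derivableInDepth α d _, derivableInDepth_of_value hC α d _ hd⟩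

end Circuit

/-! ### Trees given by parent functions -/

/-- The edges of a finite tree rooted at `none`, as a graph on `Option V`: an element `v : V` is
both a non-root vertex and the edge that joins this vertex to its parent `par v`. -/
def parentGraph {V : Type} (par : V → Option V) : SimpleGraph (Option V) :=
  SimpleGraph.fromRel fun a b => ∃ v, a = some v ∧ b = par v

section ParentGraph

variable {V : Type} {par : V → Option V} {rank : V → ℕ}

theorem par_ne_self (hpar : ∀ v u, par v = some u → rank u < rank v) (v : V) :
    some v ≠ par v := fun h => (hpar v v h.symm).false

theorem parentGraph_adj_par (hpar : ∀ v u, par v = some u → rank u < rank v) (v : V) :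
    (parentGraph par).Adj (some v) (par v) :=
  (SimpleGraph.fromRel_adj _ _ _).2 ⟨par_ne_self hpar v, .inl ⟨v, rfl, rfl⟩⟩

theorem exists_of_parentGraph_adj {a b : Option V} (h : (parentGraph par).Adj a b) :
    ∃ v, (a = some v ∧ b = par v) ∨ (b = some v ∧ a = par v) := by
  obtain ⟨-, ⟨v, hv⟩ | ⟨v, hv⟩⟩ := (SimpleGraph.fromRel_adj _ _ _).1 h
  · exact ⟨v, .inl hv⟩
  · exact ⟨v, .inr hv⟩

theorem mk_par_injective (hpar : ∀ v u, par v = some u → rank u < rank v) {v w : V}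
    (h : s(some v, par v) = s(some w, par w)) : v = w := by
  rcases Sym2.eq_iff.1 h with ⟨h1, -⟩ | ⟨h1, h2⟩
  · exact Option.some.inj h1
  · exact absurd ((hpar w v h1.symm).trans (hpar v w h2)) (lt_irrefl _)

/-- Each `v : V` stands for the edge that joins it to its parent. -/
noncomputable def parentGraphEdge (hpar : ∀ v u, par v = some u → rank u < rank v) :
    V ≃ (parentGraph par).edgeSet :=
  Equiv.ofBijective (fun v => ⟨s(some v, par v), parentGraph_adj_par hpar v⟩) <| by
    refine ⟨fun v w h => mk_par_injective hpar (congrArg Subtype.val h), ?_⟩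
    rintro ⟨⟨a, b⟩, h⟩
    obtain ⟨v, ⟨rfl, rfl⟩ | ⟨rfl, rfl⟩⟩ := exists_of_parentGraph_adj h
    · exact ⟨v, rfl⟩
    · exact ⟨v, Subtype.ext Sym2.eq_swap⟩

theorem parentGraph_reachable_none (hpar : ∀ v u, par v = some u → rank u < rank v)
    (a : Option V) : (parentGraph par).Reachable a none := by
  rcases a with _ | v
  · exact .rfl
  · induction hr : rank v using Nat.strong_induction_on generalizing v with
    | _ r ih =>
      refine (parentGraph_adj_par hpar v).reachable.trans ?_
      cases hp : par v with
      | none => exact .rfl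
      | some u => exact ih _ (hr ▸ hpar v u hp) u rfl

theorem parentGraph_isTree [Finite V] (hpar : ∀ v u, par v = some u → rank u < rank v) :
    (parentGraph par).IsTree := by
  rw [SimpleGraph.isTree_iff_connected_and_card, ← Nat.card_congr (parentGraphEdge hpar),
    Finite.card_option]
  exact ⟨⟨fun a b => (parentGraph_reachable_none hpar a).trans
    (parentGraph_reachable_none hpar b).symm⟩, rfl⟩

/-- The condition on `e` that makes it a convex subtree of `parentGraph par`: all its elements hang
from a top element `t`, and it contains all or none of the children of each of its elements. -/
def IsConvexBelow (par : V → Option V) (e : Set V) (t : V) : Prop :=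
  t ∈ e ∧ (∀ v ∈ e, v ≠ t → ∃ u ∈ e, par v = some u) ∧
    ∀ v ∈ e, ∀ u ∈ e, par v = some u → ∀ w, par w = some u → w ∈ e

theorem rank_top_le (hpar : ∀ v u, par v = some u → rank u < rank v) {e : Set V} {t : V}
    (h : ∀ v ∈ e, v ≠ t → ∃ u ∈ e, par v = some u) {v : V} (hv : v ∈ e) : rank t ≤ rank v := by
  induction hr : rank v using Nat.strong_induction_on generalizing v with
  | _ r ih =>
    by_cases hvt : v = t
    · rw [← hvt, hr]
    · obtain ⟨u, hu, hvu⟩ := h v hv hvt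
      have hlt := hpar v u hvu
      exact (ih _ (hr ▸ hlt) hu rfl).trans (hr ▸ hlt.le)

theorem isConvexSubtree_parentGraph [Finite V]
    (hpar : ∀ v u, par v = some u → rank u < rank v) {e : Set V} {t : V}
    (h : IsConvexBelow par e t) :
    IsConvexSubtree (inducedByEdges (parentGraph par) (parentGraphEdge hpar '' e)) := by
  obtain ⟨ht, htop, hsib⟩ := h
  set T' := inducedByEdges (parentGraph par) (parentGraphEdge hpar '' e) with hT'
  have hadj : ∀ a b, T'.Adj a b ↔ ∃ v ∈ e, s(some v, par v) = s(a, b) := fun a b =>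
    ⟨fun ⟨_, ⟨v, hv, h1⟩, h2⟩ => ⟨v, hv, by rw [← h2, ← h1]; rfl⟩,
      fun ⟨v, hv, h1⟩ => ⟨_, ⟨v, hv, rfl⟩, h1⟩⟩
  have hverts : ∀ a, a ∈ T'.verts ↔ ∃ v ∈ e, a = some v ∨ a = par v := fun a =>
    ⟨fun ⟨_, ⟨v, hv, h1⟩, h2⟩ => ⟨v, hv, by subst h1; exact Sym2.mem_iff.1 h2⟩,
      fun ⟨v, hv, h1⟩ => ⟨_, ⟨v, hv, rfl⟩, Sym2.mem_iff.2 h1⟩⟩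
  have hedge : ∀ v ∈ e, T'.Adj (some v) (par v) := fun v hv => (hadj _ _).2 ⟨v, hv, rfl⟩
  have hmin : ∀ v ∈ e, rank t ≤ rank v := fun v hv => rank_top_le hpar htop hv
  have hpt : ∀ v ∈ e, par t ≠ some v := fun v hv hv' =>
    absurd (hmin v hv) (not_le.2 (hpar t v hv'))
  -- Every vertex is connected to the upper end of the top edge.
  have hreach : ∀ v (hv : v ∈ e), T'.coe.Reachable ⟨some v, (hverts _).2 ⟨v, hv, .inl rfl⟩⟩
      ⟨par t, (hverts _).2 ⟨t, ht, .inr rfl⟩⟩ := by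
    intro v hv
    induction hr : rank v using Nat.strong_induction_on generalizing v with
    | _ r ih =>
      by_cases hvt : v = t
      · subst hvt
        exact SimpleGraph.Adj.reachable (hedge v hv)
      · obtain ⟨u, hu, hvu⟩ := htop v hv hvt
        refine SimpleGraph.Reachable.trans (SimpleGraph.Adj.reachable ?_)
          (ih _ (hr ▸ hpar v u hvu) u hu rfl)
        have := hedge v hv
        rw [hvu] at this
        exact this
  have hreach' : ∀ a : T'.verts,
      T'.coe.Reachable a ⟨par t, (hverts _).2 ⟨t, ht, .inr rfl⟩⟩ := by
    rintro ⟨a, ha⟩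
    obtain ⟨v, hv, rfl | rfl⟩ := (hverts a).1 ha
    · exact hreach v hv
    · have hvp : T'.coe.Adj ⟨some v, (hverts _).2 ⟨v, hv, .inl rfl⟩⟩ ⟨par v, ha⟩ := hedge v hv
      exact hvp.symm.reachable.trans (hreach v hv)
  refine ⟨⟨?_, (parentGraph_isTree hpar).isAcyclic.subgraph T'⟩, ?_⟩
  · exact { preconnected := fun a b => (hreach' a).trans (hreach' b).symm
            nonempty := ⟨⟨par t, (hverts _).2 ⟨t, ht, .inr rfl⟩⟩⟩ }
  · intro a ha hleaf b hab
    obtain ⟨w, hw, rfl⟩ : ∃ w ∈ e, a = some w := by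
      obtain ⟨v, hv, rfl | rfl⟩ := (hverts a).1 ha
      · exact ⟨v, hv, rfl⟩
      · by_cases hvt : v = t
        · -- The upper end of the top edge is a leaf.
          subst hvt
          refine absurd ⟨ha, Set.ncard_eq_one.2 ⟨some v, ?_⟩⟩ hleaf
          ext b
          simp only [SimpleGraph.Subgraph.mem_neighborSet, hadj, Set.mem_singleton_iff]
          constructor
          · rintro ⟨x, hx, hxe⟩
            rcases Sym2.eq_iff.1 hxe with ⟨h1, -⟩ | ⟨rfl, h2⟩
            · exact absurd h1.symm (hpt x hx)
            · by_contra hne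
              obtain ⟨u, hu, hxu⟩ := htop x hx fun h => hne (h ▸ rfl)
              exact hpt u hu (h2 ▸ hxu)
          · rintro rfl
            exact ⟨v, hv, Sym2.eq_swap⟩
        · obtain ⟨u, hu, hvu⟩ := htop v hv hvt
          exact ⟨u, hu, hvu⟩
    obtain ⟨v, ⟨h1, rfl⟩ | ⟨rfl, h2⟩⟩ := exists_of_parentGraph_adj hab
    · obtain rfl := Option.some.inj h1
      exact hedge _ hw
    · by_cases hc : ∃ c ∈ e, par c = some w
      · obtain ⟨c, hce, hcw⟩ := hc
        have := hedge v (hsib c hce w hw hcw v h2.symm)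
        rw [← h2] at this
        exact this.symm
      · -- Without a child in `e`, the vertex `w` is a leaf.
        refine absurd ⟨ha, Set.ncard_eq_one.2 ⟨par w, ?_⟩⟩ hleaf
        ext b
        simp only [SimpleGraph.Subgraph.mem_neighborSet, hadj, Set.mem_singleton_iff]
        constructor
        · rintro ⟨x, hx, hxe⟩
          rcases Sym2.eq_iff.1 hxe with ⟨h1, rfl⟩ | ⟨-, h3⟩
          · rw [Option.some.inj h1]
          · exact absurd ⟨x, hx, h3⟩ hc
        · rintro rfl
          exact ⟨w, hw, rfl⟩

/-- A hypergraph on the edges of a rooted tree is a tree hypergraph if each of its hyperedges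
satisfies `IsConvexBelow`. -/
theorem isTreeHypergraph_of_par [Finite V] (hpar : ∀ v u, par v = some u → rank u < rank v)
    {E : Finset (Finset V)} (hE : ∀ e ∈ E, ∃ t, IsConvexBelow par (e : Set V) t) :
    IsTreeHypergraph E :=
  ⟨Option V, inferInstance, parentGraph par, parentGraphEdge hpar, parentGraph_isTree hpar,
    fun e he => (hE e he).elim fun _ ht => isConvexSubtree_parentGraph hpar ht⟩

end ParentGraph

/-! ### Rooting a tree hypergraph -/

section Rooting

variable {W : Type} {T : SimpleGraph W}

/-- A vertex of a tree has at most one neighbour closer to the root `r`. -/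
theorem eq_of_adj_of_dist_add_one (hT : T.IsTree) (r : W) {x y y' : W} (h : T.Adj x y)
    (h' : T.Adj x y') (hd : T.dist r y + 1 = T.dist r x) (hd' : T.dist r y' + 1 = T.dist r x) :
    y = y' := by
  obtain ⟨q, hq, hql⟩ := (hT.connected r x).exists_path_of_dist
  have key : ∀ y, T.Adj x y → T.dist r y + 1 = T.dist r x → y = q.penultimate := by
    intro y h hd
    refine hT.isAcyclic.eq_penultimate_of_adj_end hq h ?_
    by_contra hy
    obtain ⟨p, hp, hpl⟩ := (hT.connected r y).exists_path_of_dist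
    have hx := hT.isAcyclic.mem_support_of_ne_mem_support_of_adj_of_isPath hp hq h.symm hy
    have := congrArg SimpleGraph.Walk.length (hT.isAcyclic.path_concat hq hp h hx)
    rw [SimpleGraph.Walk.length_concat] at this
    omega
  rw [key y h hd, key y' h' hd']

/-- A path whose first step leads away from the root `r` never turns back. -/
theorem dist_lt_of_isPath_cons (hT : T.IsTree) (r : W) {x y z : W} (h : T.Adj x y)
    (p : T.Walk y z) (hp : (p.cons h).IsPath) (hd : T.dist r y = T.dist r x + 1) :
    T.dist r x < T.dist r z := by
  induction p generalizing x with
  | nil => omega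
  | @cons y w z h' p ih =>
    rcases hT.dist_eq_dist_add_one_of_adj r h' with hw | hw
    · obtain rfl := eq_of_adj_of_dist_add_one hT r h.symm h' hd.symm hw.symm
      have := ((SimpleGraph.Walk.cons_isPath_iff _ _).1 hp).2
      simp at this
    · have := ih h' hp.of_cons hw
      omega

theorem exists_adj_dist_add_one (hT : T.IsTree) (r : W) {x : W} (hx : x ≠ r) :
    ∃ y, T.Adj x y ∧ T.dist r y + 1 = T.dist r x := by
  obtain ⟨p, hp⟩ := hT.connected.exists_isPath x r
  cases p with
  | nil => exact absurd rfl hx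
  | @cons _ y _ h p =>
    rcases hT.dist_eq_dist_add_one_of_adj r h with hw | hw
    · exact ⟨y, h, hw.symm⟩
    · have := dist_lt_of_isPath_cons hT r h p hp hw
      simp at this

/-- The underlying tree of a tree hypergraph can be rooted in such a way that every hyperedge has a
top element, with which all its other elements are connected by chains of parents inside the
hyperedge. -/
theorem IsTreeHypergraph.exists_par {V : Type} {E : Finset (Finset V)} (hE : IsTreeHypergraph E) :
    ∃ (par : V → Option V) (rank : V → ℕ), (∀ v u, par v = some u → rank u < rank v) ∧
      ∀ e ∈ E, ∃ t ∈ e, ∀ v ∈ e, v ≠ t → ∃ u ∈ e, par v = some u := by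
  classical
  obtain ⟨W, hW, T, φ, hT, hconv⟩ := hE
  have := Fintype.ofFinite W
  rcases isEmpty_or_nonempty V with hV | ⟨⟨v⟩⟩
  · refine ⟨fun _ => none, fun _ => 0, fun v => (IsEmpty.false v).elim, fun e he => ?_⟩
    obtain ⟨⟨a, s, ⟨v, -⟩, -⟩⟩ := (hconv e he).1.connected.nonempty
    exact (IsEmpty.false v).elim
  have hnt : Nontrivial W := by
    obtain ⟨⟨a, b⟩, h⟩ := φ v
    exact ⟨a, b, T.ne_of_adj h⟩
  -- The root is a leaf: a hyperedge through an inner root could have several topmost elements.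
  obtain ⟨r, hr⟩ := hT.exists_vert_degree_one_of_nontrivial
  rw [SimpleGraph.degree_eq_one_iff_existsUnique_adj] at hr
  have hex : ∀ x, ∃ y, x ≠ r → T.Adj x y ∧ T.dist r y + 1 = T.dist r x := by
    intro x
    by_cases hx : x = r
    · exact ⟨x, fun h => absurd hx h⟩
    · exact (exists_adj_dist_add_one hT r hx).imp fun y hy _ => hy
  choose pr hpr using hex
  have hup : ∀ x y, T.Adj x y → T.dist r y + 1 = T.dist r x → x ≠ r ∧ y = pr x := by
    intro x y h hd
    have hx : x ≠ r := by
      rintro rfl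
      simp at hd
    exact ⟨hx, eq_of_adj_of_dist_add_one hT r h (hpr x hx).1 hd (hpr x hx).2⟩
  have hlow : ∀ v, ∃ x, x ≠ r ∧ (φ v : Sym2 W) = s(x, pr x) := by
    intro v
    obtain ⟨⟨a, b⟩, h⟩ := φ v
    rcases hT.dist_eq_dist_add_one_of_adj r h with hd | hd
    · obtain ⟨h1, h2⟩ := hup a b h hd.symm
      exact ⟨a, h1, by rw [← h2]⟩
    · obtain ⟨h1, h2⟩ := hup b a (SimpleGraph.Adj.symm h) hd.symm
      exact ⟨b, h1, by rw [← h2]; exact Sym2.eq_swap⟩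
  choose low hlowr hφ using hlow
  have hinj : ∀ x y, x ≠ r → y ≠ r → s(x, pr x) = s(y, pr y) → x = y := by
    intro x y hx hy h
    rcases Sym2.eq_iff.1 h with ⟨h1, -⟩ | ⟨h1, h2⟩
    · exact h1
    · have hx := (hpr x hx).2
      have hy := (hpr y hy).2
      rw [h2] at hx
      rw [← h1] at hy
      omega
  have hlowinj : ∀ v w, low v = low w → v = w := fun v w h =>
    φ.injective (Subtype.ext (by rw [hφ, hφ, h]))
  have hedge : ∀ x, ∃ v, x ≠ r → low v = x := by
    intro x
    by_cases hx : x = r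
    · exact ⟨v, fun h => absurd hx h⟩
    · refine ⟨φ.symm ⟨s(x, pr x), (hpr x hx).1⟩, fun _ => hinj _ _ (hlowr _) hx ?_⟩
      rw [← hφ, Equiv.apply_symm_apply]
  choose edge hedge using hedge
  refine ⟨fun v => if pr (low v) = r then none else some (edge (pr (low v))),
    fun v => T.dist r (low v), ?_, ?_⟩
  · intro v u h
    change (if pr (low v) = r then none else _) = _ at h
    split_ifs at h with hv
    obtain rfl := Option.some.inj h
    change T.dist r (low (edge _)) < T.dist r (low v)
    rw [hedge _ hv]
    have := (hpr _ (hlowr v)).2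
    omega
  intro e he
  obtain ⟨htree, hleaf⟩ := hconv e he
  set T' := inducedByEdges T (φ '' e) with hT'
  have hadj : ∀ a b, T'.Adj a b ↔ ∃ v ∈ e, s(low v, pr (low v)) = s(a, b) := fun a b =>
    ⟨fun ⟨_, ⟨v, hv, h1⟩, h2⟩ => ⟨v, hv, by rw [← h2, ← h1, hφ]⟩,
      fun ⟨v, hv, h1⟩ => ⟨_, ⟨v, hv, rfl⟩, by rw [hφ, h1]⟩⟩
  have hverts : ∀ a, a ∈ T'.verts ↔ ∃ v ∈ e, a = low v ∨ a = pr (low v) := fun a =>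
    ⟨fun ⟨_, ⟨v, hv, h1⟩, h2⟩ => ⟨v, hv, by subst h1; rw [hφ] at h2; exact Sym2.mem_iff.1 h2⟩,
      fun ⟨v, hv, h1⟩ => ⟨_, ⟨v, hv, rfl⟩, by rw [hφ]; exact Sym2.mem_iff.2 h1⟩⟩
  obtain ⟨z, hz, hmin⟩ := Set.exists_min_image T'.verts (T.dist r) (Set.toFinite _)
    (htree.connected.nonempty.elim fun a => ⟨a, a.2⟩)
  -- The vertex `z` of `T'` closest to the root is a leaf of `T'`.
  have hnup : ∀ x, x ≠ r → T'.Adj x (pr x) → x ≠ z := by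
    rintro x hx h rfl
    have := hmin _ (T'.edge_vert h.symm)
    have := (hpr x hx).2
    omega
  have hupadj : ∀ x ∈ T'.verts, x ≠ z → x ≠ r ∧ T'.Adj x (pr x) := by
    intro x hx hxz
    obtain ⟨p, hp⟩ := htree.connected.exists_isPath ⟨x, hx⟩ ⟨z, hz⟩
    cases p with
    | nil => exact absurd rfl hxz
    | @cons _ y _ h p =>
      have hp' := SimpleGraph.Walk.IsPath.map T'.hom_injective hp
      rw [SimpleGraph.Walk.map_cons] at hp'
      have hxy : T'.Adj x y := h
      rcases hT.dist_eq_dist_add_one_of_adj r hxy.adj_sub with hd | hd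
      · obtain ⟨h1, h2⟩ := hup x y hxy.adj_sub hd.symm
        exact ⟨h1, h2 ▸ hxy⟩
      · have := dist_lt_of_isPath_cons hT r _ _ hp' hd
        exact absurd (hmin x hx) (not_le.2 this)
  have hlowadj : ∀ v ∈ e, T'.Adj (low v) (pr (low v)) := fun v hv => (hadj _ _).2 ⟨v, hv, rfl⟩
  obtain ⟨t, ht, hzt⟩ : ∃ t ∈ e, z = pr (low t) := by
    obtain ⟨t, ht, h | h⟩ := (hverts z).1 hz
    · exact absurd h.symm (hnup _ (hlowr t) (hlowadj t ht))
    · exact ⟨t, ht, h⟩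
  refine ⟨t, ht, fun v hv hvt => ?_⟩
  have hvz : pr (low v) ≠ z := by
    intro hvz
    refine hvt (hlowinj _ _ ?_)
    have h1 := hlowadj v hv
    have h2 := hlowadj t ht
    rw [hvz] at h1
    rw [← hzt] at h2
    by_cases hzr : z = r
    · subst hzr
      exact hr.unique h1.adj_sub.symm h2.adj_sub.symm
    · by_cases hl : IsLeaf T' z
      · obtain ⟨a, ha⟩ := Set.ncard_eq_one.1 hl.2
        have h1 : low v ∈ T'.neighborSet z := h1.symm
        have h2 : low t ∈ T'.neighborSet z := h2.symm
        rw [ha] at h1 h2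
        rw [Set.mem_singleton_iff.1 h1, Set.mem_singleton_iff.1 h2]
      · exact absurd rfl (hnup z hzr (hleaf z hz hl _ (hpr z hzr).1))
  obtain ⟨h1, h2⟩ := hupadj _ ((hverts _).2 ⟨v, hv, .inr rfl⟩) hvz
  obtain ⟨u, hu, hue⟩ := (hadj _ _).1 h2
  refine ⟨u, hu, ?_⟩
  have hlu := hinj _ _ (hlowr u) h1 hue
  change (if pr (low v) = r then none else _) = _
  rw [if_neg h1, hlowinj u (edge (pr (low v))) (by rw [hedge _ h1, hlu])]

end Rooting

/-! ### The skeleton tree -/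

/-- The labelling of the nodes `1, 2, 3, …` of an infinite binary tree, with `ν` having the children
`2 * ν` and `2 * ν + 1`, that is determined by the label `a` of the root `1` and the labels `l x`
and `r x` of the children of a node with label `x`. -/
def heapLabel {A : Type} (a : A) (l r : A → A) (ν : ℕ) : A :=
  if h : ν ≤ 1 then a
  else if ν % 2 = 0 then l (heapLabel a l r (ν / 2)) else r (heapLabel a l r (ν / 2))
termination_by ν
decreasing_by all_goals omega

theorem heapLabel_one {A : Type} (a : A) (l r : A → A) : heapLabel a l r 1 = a := by
  rw [heapLabel]; simp

theorem heapLabel_left {A : Type} (a : A) (l r : A → A) {ν : ℕ} (h : 1 ≤ ν) :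
    heapLabel a l r (2 * ν) = l (heapLabel a l r ν) := by
  rw [heapLabel, dif_neg (by omega), if_pos (by omega), Nat.mul_div_cancel_left _ (by norm_num)]

theorem heapLabel_right {A : Type} (a : A) (l r : A → A) {ν : ℕ} (h : 1 ≤ ν) :
    heapLabel a l r (2 * ν + 1) = r (heapLabel a l r ν) := by
  rw [heapLabel, dif_neg (by omega), if_neg (by omega), show (2 * ν + 1) / 2 = ν by omega]

/-- The edges of the skeleton: a complete binary tree with nodes `1, …, 2 ^ (d + 1) - 1`, numbered
such that `ν` has the children `2 * ν` and `2 * ν + 1`, in which every node hangs from its parent by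
a path of `2 * N + 1` edges. The edge `(ν, i)` is the `i`-th one, counted from the parent, of the
path that ends in `ν`. The path of the additional node `0` hangs from the root of the tree, and
node `1` hangs from node `0`. -/
abbrev Skeleton (d N : ℕ) : Type := Fin (2 ^ (d + 1)) × Fin (2 * N + 1)

section Skeleton

variable {d N : ℕ}

/-- The edge of the skeleton just above a given edge. -/
def skeletonPar (v : Skeleton d N) : Option (Skeleton d N) :=
  if v.2.val = 0 then
    if v.1.val = 0 then none
    else some (⟨v.1 / 2, (Nat.div_le_self _ _).trans_lt v.1.2⟩, Fin.last _)
  else some (v.1, ⟨v.2 - 1, (Nat.sub_le _ _).trans_lt v.2.2⟩)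

theorem skeletonPar_eq_some_iff {v u : Skeleton d N} : skeletonPar v = some u ↔
    (u.1.val = v.1 ∧ u.2.val + 1 = v.2) ∨
      (v.2.val = 0 ∧ v.1.val ≠ 0 ∧ u.1.val = v.1 / 2 ∧ u.2.val = 2 * N) := by
  unfold skeletonPar
  split_ifs with h1 h2
  · exact ⟨fun h => by simp at h, by omega⟩
  · rw [Option.some.injEq, Prod.ext_iff, Fin.ext_iff, Fin.ext_iff]
    simp only [Fin.val_last]
    omega
  · rw [Option.some.injEq, Prod.ext_iff, Fin.ext_iff, Fin.ext_iff]
    dsimp only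
    omega

theorem skeletonPar_rank (v u : Skeleton d N) (h : skeletonPar v = some u) :
    u.1.val * (2 * N + 1) + u.2.val < v.1.val * (2 * N + 1) + v.2.val := by
  rcases skeletonPar_eq_some_iff.1 h with ⟨h1, h2⟩ | ⟨h1, h2, h3, h4⟩
  · rw [h1]; omega
  · have : (u.1.val + 1) * (2 * N + 1) ≤ v.1.val * (2 * N + 1) :=
      Nat.mul_le_mul_right _ (by omega)
    rw [add_mul] at this
    omega

variable (d N) in
/-- The hyperedge around node `ν`: it leaves the first `2 * a + 2` edges of the path above `ν`
uncovered and covers the first `2 * b + 1` and `2 * c + 1` edges of the paths to its children. -/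
def nodeEdge (ν a b c : ℕ) : Finset (Skeleton d N) :=
  Finset.univ.filter fun v => (v.1.val = ν ∧ 2 * a + 2 ≤ v.2.val) ∨
    (v.1.val = 2 * ν ∧ v.2.val ≤ 2 * b) ∨ (v.1.val = 2 * ν + 1 ∧ v.2.val ≤ 2 * c)

variable (d N) in
/-- The hyperedge around node `0`, which covers the first `2 * a + 1` edges of the path to
node `1`. -/
def rootEdge (a : ℕ) : Finset (Skeleton d N) :=
  Finset.univ.filter fun v => (v.1.val = 0 ∧ v.2.val = 2 * N) ∨ (v.1.val = 1 ∧ v.2.val ≤ 2 * a)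

theorem mem_nodeEdge {ν a b c : ℕ} {v : Skeleton d N} : v ∈ nodeEdge d N ν a b c ↔
    (v.1.val = ν ∧ 2 * a + 2 ≤ v.2.val) ∨ (v.1.val = 2 * ν ∧ v.2.val ≤ 2 * b) ∨
      (v.1.val = 2 * ν + 1 ∧ v.2.val ≤ 2 * c) := by
  simp [nodeEdge]

theorem mem_rootEdge {a : ℕ} {v : Skeleton d N} : v ∈ rootEdge d N a ↔
    (v.1.val = 0 ∧ v.2.val = 2 * N) ∨ (v.1.val = 1 ∧ v.2.val ≤ 2 * a) := by
  simp [rootEdge]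

theorem exists_skeletonPar (v : Skeleton d N) (h : ¬(v.1.val = 0 ∧ v.2.val = 0)) :
    ∃ u, skeletonPar v = some u := by
  unfold skeletonPar
  split_ifs <;> simp_all

theorem isConvexBelow_nodeEdge {ν a b c : ℕ} (hν : 1 ≤ ν) (hν' : ν < 2 ^ (d + 1)) (ha : a < N) :
    ∃ t, IsConvexBelow skeletonPar (nodeEdge d N ν a b c : Set (Skeleton d N)) t := by
  refine ⟨(⟨ν, hν'⟩, ⟨2 * a + 2, by omega⟩), ?_, ?_, ?_⟩
  · simp [mem_nodeEdge]
  · intro v hv hvt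
    rw [Finset.mem_coe, mem_nodeEdge] at hv
    simp only [ne_eq, Prod.ext_iff, Fin.ext_iff] at hvt
    obtain ⟨u, hu⟩ := exists_skeletonPar v (by omega)
    refine ⟨u, ?_, hu⟩
    rw [skeletonPar_eq_some_iff] at hu
    rw [Finset.mem_coe, mem_nodeEdge]
    omega
  · intro v hv u hu hvu w hwu
    rw [skeletonPar_eq_some_iff] at hvu hwu
    rw [Finset.mem_coe, mem_nodeEdge] at hv hu ⊢
    have := v.2.2
    have := w.2.2
    omega

theorem isConvexBelow_rootEdge (a : ℕ) :
    ∃ t, IsConvexBelow skeletonPar (rootEdge d N a : Set (Skeleton d N)) t := by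
  refine ⟨(⟨0, by positivity⟩, Fin.last _), ?_, ?_, ?_⟩
  · simp [mem_rootEdge]
  · intro v hv hvt
    rw [Finset.mem_coe, mem_rootEdge] at hv
    simp only [ne_eq, Prod.ext_iff, Fin.ext_iff, Fin.val_last] at hvt
    obtain ⟨u, hu⟩ := exists_skeletonPar v (by omega)
    refine ⟨u, ?_, hu⟩
    rw [skeletonPar_eq_some_iff] at hu
    rw [Finset.mem_coe, mem_rootEdge]
    omega
  · intro v hv u hu hvu w hwu
    rw [skeletonPar_eq_some_iff] at hvu hwu
    rw [Finset.mem_coe, mem_rootEdge] at hv hu ⊢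
    have := v.2.2
    have := w.2.2
    omega

end Skeleton

/-! ### Inference systems as tree hypergraph programs -/

namespace InferenceSystem

variable {n : ℕ} (S : InferenceSystem n) (d : ℕ)

/-- The number of an item. -/
noncomputable def num (x : S.Item) : ℕ := Fintype.equivFin S.Item x

theorem num_lt (x : S.Item) : S.num x < Fintype.card S.Item := (Fintype.equivFin S.Item x).2

theorem num_injective : Function.Injective S.num :=
  Fin.val_injective.comp (Fintype.equivFin S.Item).injective

/-- The labels of the skeleton. The edges in even position have to be covered. Those in odd
position matter only above the leaves of the binary tree, where the edge in position
`2 * S.num x + 1` is labelled by the axiom for `x`. -/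
noncomputable def skeletonLabel (v : Skeleton d (Fintype.card S.Item)) : VLabel n :=
  if v.1.val = 0 then .const true
  else if v.2.val % 2 = 0 then .const false
  else if h : 2 ^ d ≤ v.1.val ∧ v.2.val / 2 < Fintype.card S.Item then
    S.ax ((Fintype.equivFin S.Item).symm ⟨v.2.val / 2, h.2⟩)
  else .const true

open Classical in
/-- The hyperedges around the nodes `ν`, one for each rule that may be applied at `ν`. No rule is
needed at the leaves of the binary tree. -/
noncomputable def skeletonEdges : Finset (Finset (Skeleton d (Fintype.card S.Item))) :=
  insert (rootEdge _ _ (S.num S.goal))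
    ((Finset.univ.filter fun p : Fin (2 ^ (d + 1)) × S.Item × S.Item × S.Item =>
        1 ≤ p.1.val ∧ (p.1.val < 2 ^ d → S.rule p.2.1 p.2.2.1 p.2.2.2)).image
      fun p => nodeEdge _ _ p.1 (S.num p.2.1) (S.num p.2.2.1) (S.num p.2.2.2))

/-- A tree hypergraph program that looks for a derivation of the goal in the form of a complete
binary tree of depth `d`. -/
noncomputable def toHGP : HGP n where
  V := Skeleton d (Fintype.card S.Item)
  E := S.skeletonEdges d
  label := S.skeletonLabel d

variable {S d}

theorem mem_skeletonEdges {e : Finset (Skeleton d (Fintype.card S.Item))} :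
    e ∈ S.skeletonEdges d ↔
      e = rootEdge _ _ (S.num S.goal) ∨ ∃ ν x y z, 1 ≤ ν ∧ ν < 2 ^ (d + 1) ∧
        (ν < 2 ^ d → S.rule x y z) ∧ e = nodeEdge _ _ ν (S.num x) (S.num y) (S.num z) := by
  simp only [skeletonEdges, Finset.mem_insert, Finset.mem_image, Finset.mem_filter,
    Finset.mem_univ, true_and]
  refine or_congr_right ⟨?_, ?_⟩
  · rintro ⟨⟨ν, x, y, z⟩, ⟨h1, h2⟩, rfl⟩
    exact ⟨ν, x, y, z, h1, ν.2, h2, rfl⟩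
  · rintro ⟨ν, x, y, z, h1, h2, h3, rfl⟩
    exact ⟨⟨⟨ν, h2⟩, x, y, z⟩, ⟨h1, h3⟩, rfl⟩

theorem isTHGP_toHGP : (S.toHGP d).IsTHGP := by
  refine isTreeHypergraph_of_par (V := Skeleton d (Fintype.card S.Item)) skeletonPar_rank ?_
  intro e he
  rcases mem_skeletonEdges.1 he with rfl | ⟨ν, x, y, z, h1, h2, -, rfl⟩
  · exact isConvexBelow_rootEdge _
  · exact isConvexBelow_nodeEdge h1 h2 (S.num_lt x)

theorem IsMonotone.toHGP (hS : S.IsMonotone) : (S.toHGP d).IsMonotone := by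
  intro v i h
  change S.skeletonLabel d v = _ at h
  unfold skeletonLabel at h
  split_ifs at h
  exact hS _ _ h

theorem size_toHGP_le : (S.toHGP d).size ≤
    2 ^ (d + 1) * (2 * Fintype.card S.Item + 1) + (2 ^ (d + 1) * Fintype.card S.Item ^ 3 + 1) := by
  classical
  unfold HGP.size
  refine Nat.add_le_add (le_of_eq ?_) (?_ : (S.skeletonEdges d).card ≤ _)
  · change Fintype.card (Skeleton d (Fintype.card S.Item)) = _
    simp
  · refine (Finset.card_insert_le _ _).trans (Nat.succ_le_succ (Finset.card_image_le.trans
      ((Finset.card_filter_le _ _).trans (le_of_eq ?_))))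
    simp
    ring

theorem eval_skeletonLabel_even {α : Fin n → Bool} {v : Skeleton d (Fintype.card S.Item)}
    (h1 : v.1.val ≠ 0) (h2 : v.2.val % 2 = 0) : (S.skeletonLabel d v).eval α = false := by
  rw [skeletonLabel, if_neg h1, if_pos h2]; rfl

theorem skeletonLabel_leaf {v : Skeleton d (Fintype.card S.Item)} {x : S.Item}
    (h1 : 2 ^ d ≤ v.1.val) (h2 : v.2.val = 2 * S.num x + 1) : S.skeletonLabel d v = S.ax x := by
  have h0 : v.1.val ≠ 0 := (Nat.two_pow_pos d |>.trans_le h1).ne'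
  have hx : v.2.val / 2 = S.num x := by omega
  rw [skeletonLabel, if_neg h0, if_neg (by omega), dif_pos ⟨h1, hx ▸ S.num_lt x⟩]
  congr 1
  rw [Equiv.symm_apply_eq, Fin.ext_iff]
  exact hx

/-- If the hyperedges of an independent cover that come from above cover exactly the first
`2 * S.num x + 1` edges of the path to the node `ν` at height `h`, then `x` has a derivation of
depth `h`: the hyperedge around `ν` has to be one of those for the rules with conclusion `x`. -/
theorem derivableInDepth_of_cover {α : Fin n → Bool}
    {E' : Finset (Finset (Skeleton d (Fintype.card S.Item)))} (hE : E' ⊆ S.skeletonEdges d)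
    (hdisj : ∀ e ∈ E', ∀ e' ∈ E', e ≠ e' → Disjoint e e')
    (hcov : ∀ v, (S.skeletonLabel d v).eval α = false → ∃ e ∈ E', v ∈ e) (h k : ℕ)
    (hhk : h + k = d) (ν : ℕ) (hν : 2 ^ k ≤ ν) (hν' : ν < 2 ^ (k + 1)) (x : S.Item)
    {f : Finset (Skeleton d (Fintype.card S.Item))} (hf : f ∈ E')
    (hfν : ∀ v : Skeleton d (Fintype.card S.Item),
      v.1.val = ν → (v ∈ f ↔ v.2.val ≤ 2 * S.num x)) :
    S.DerivableInDepth α h x := by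
  have hkd : 2 ^ (k + 1) ≤ 2 ^ (d + 1) := Nat.pow_le_pow_right (by norm_num) (by omega)
  have hν1 : 1 ≤ ν := (Nat.one_le_two_pow).trans hν
  have hx := S.num_lt x
  have key : ∀ v : Skeleton d (Fintype.card S.Item), v.1.val = ν → 2 * S.num x < v.2.val →
      ∀ e ∈ E', v ∈ e → ∃ a b c, e = nodeEdge _ _ ν (S.num a) (S.num b) (S.num c) ∧
        (ν < 2 ^ d → S.rule a b c) ∧ S.num x ≤ S.num a ∧ 2 * S.num a + 2 ≤ v.2.val := by
    intro v hv hvx e he hve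
    have hne : ∀ w : Skeleton d (Fintype.card S.Item), w.1.val = ν → w.2.val ≤ 2 * S.num x →
        w ∉ e := by
      intro w hw hwx hwe
      by_cases hef : e = f
      · subst hef
        exact absurd ((hfν v hv).1 hve) (not_le.2 hvx)
      · exact Finset.disjoint_left.1 (hdisj e he f hf hef) hwe ((hfν w hw).2 hwx)
    have h0 := hne (v.1, 0) hv (Nat.zero_le _)
    rcases mem_skeletonEdges.1 (hE he) with rfl | ⟨μ, a, b, c, hμ, hμ', hr, rfl⟩
    · rw [mem_rootEdge] at hve h0
      simp only [Fin.val_zero] at h0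
      omega
    · rw [mem_nodeEdge] at hve h0
      simp only [Fin.val_zero] at h0
      obtain ⟨rfl, ha⟩ : ν = μ ∧ 2 * S.num a + 2 ≤ v.2.val := by omega
      have h1 := hne (v.1, ⟨2 * S.num x, by omega⟩) hv le_rfl
      rw [mem_nodeEdge] at h1
      dsimp only at h1
      exact ⟨a, b, c, rfl, hr, by omega, ha⟩
  cases h with
  | zero =>
    obtain rfl : k = d := by omega
    have hl : S.skeletonLabel k (⟨ν, hν'⟩, ⟨2 * S.num x + 1, by omega⟩) = S.ax x :=
      skeletonLabel_leaf hν rfl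
    change (S.ax x).eval α = true
    rw [← hl, ← Bool.not_eq_false]
    intro hfalse
    obtain ⟨e, he, hve⟩ := hcov _ hfalse
    obtain ⟨a, b, c, -, -, h1, h2⟩ := key _ rfl (Nat.lt_succ_self _) e he hve
    dsimp only at h2
    omega
  | succ h =>
    obtain ⟨e, he, hve⟩ := hcov (⟨ν, hν'.trans_le hkd⟩, ⟨2 * S.num x + 2, by omega⟩)
      (eval_skeletonLabel_even (Nat.one_le_iff_ne_zero.1 hν1) (by dsimp only; omega))
    obtain ⟨a, b, c, rfl, hr, h1, h2⟩ := key _ rfl (by dsimp only; omega) e he hve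
    dsimp only at h2
    obtain rfl : a = x := S.num_injective (by omega)
    have hkd' : 2 ^ (k + 1) ≤ 2 ^ d := Nat.pow_le_pow_right (by norm_num) (by omega)
    have h3 : 2 ^ (k + 1 + 1) = 2 * 2 ^ (k + 1) := pow_succ' _ _
    have h4 : 2 ^ (k + 1) = 2 * 2 ^ k := pow_succ' _ _
    refine ⟨b, c, hr (by omega), ?_, ?_⟩
    · refine derivableInDepth_of_cover hE hdisj hcov h (k + 1) (by omega) (2 * ν) (by omega)
        (by omega) b he fun v hv => ?_
      rw [mem_nodeEdge]
      omega
    · refine derivableInDepth_of_cover hE hdisj hcov h (k + 1) (by omega) (2 * ν + 1) (by omega)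
        (by omega) c he fun v hv => ?_
      rw [mem_nodeEdge]
      omega
termination_by h

theorem accepts_toHGP_def {α : Fin n → Bool} : (S.toHGP d).Accepts α ↔
    ∃ E' ⊆ S.skeletonEdges d, (∀ e ∈ E', ∀ e' ∈ E', e ≠ e' → Disjoint e e') ∧
      ∀ v, (S.skeletonLabel d v).eval α = false → ∃ e ∈ E', v ∈ e :=
  Iff.rfl

theorem derivableInDepth_of_accepts {α : Fin n → Bool} (h : (S.toHGP d).Accepts α) :
    S.DerivableInDepth α d S.goal := by
  obtain ⟨E', hE, hdisj, hcov⟩ := accepts_toHGP_def.1 h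
  have h2 : 2 ^ (d + 1) = 2 * 2 ^ d := pow_succ' _ _
  have h1 : 1 ≤ 2 ^ d := Nat.one_le_two_pow
  -- Only the hyperedge around node `0` covers the first edge of the path above node `1`.
  obtain ⟨e, he, hve⟩ := hcov (⟨1, by omega⟩, 0)
    (eval_skeletonLabel_even (S := S) (d := d) one_ne_zero rfl)
  rcases mem_skeletonEdges.1 (hE he) with rfl | ⟨μ, a, b, c, hμ, hμ', hr, rfl⟩
  · refine derivableInDepth_of_cover hE hdisj hcov d 0 (by omega) 1 (by norm_num) (by norm_num) _
      he fun v hv => ?_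
    rw [mem_rootEdge]
    omega
  · rw [mem_nodeEdge] at hve
    simp only [Fin.val_zero] at hve
    omega

theorem accepts_of_derivableInDepth {α : Fin n → Bool} (h : S.DerivableInDepth α d S.goal) :
    (S.toHGP d).Accepts α := by
  classical
  have hch : ∀ p : S.Item × ℕ, ∃ q : S.Item × S.Item, ∀ k, p.2 = k + 1 →
      S.DerivableInDepth α p.2 p.1 → S.rule p.1 q.1 q.2 ∧
        S.DerivableInDepth α k q.1 ∧ S.DerivableInDepth α k q.2 := by
    rintro ⟨x, _ | k⟩
    · exact ⟨(x, x), fun k hk => by simp at hk⟩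
    · by_cases hx : S.DerivableInDepth α (k + 1) x
      · obtain ⟨y, z, hr, hy, hz⟩ := id hx
        refine ⟨(y, z), fun j hj _ => ?_⟩
        obtain rfl : k = j := Nat.succ.inj hj
        exact ⟨hr, hy, hz⟩
      · exact ⟨(x, x), fun j hj h => absurd h hx⟩
  choose q hq using hch
  -- The item derived at a node, together with the height of the node.
  set st : ℕ → S.Item × ℕ := heapLabel (S.goal, d) (fun p => ((q p).1, p.2 - 1))
    (fun p => ((q p).2, p.2 - 1)) with hst
  have hleft : ∀ ν, 1 ≤ ν → st (2 * ν) = ((q (st ν)).1, (st ν).2 - 1) :=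
    fun ν hν => heapLabel_left _ _ _ hν
  have hright : ∀ ν, 1 ≤ ν → st (2 * ν + 1) = ((q (st ν)).2, (st ν).2 - 1) :=
    fun ν hν => heapLabel_right _ _ _ hν
  have hinv : ∀ k ν, k ≤ d → 2 ^ k ≤ ν → ν < 2 ^ (k + 1) →
      (st ν).2 + k = d ∧ S.DerivableInDepth α (st ν).2 (st ν).1 := by
    intro k
    induction k with
    | zero =>
      intro ν _ h1 h2
      obtain rfl : ν = 1 := by omega
      rw [hst, heapLabel_one]
      exact ⟨rfl, h⟩
    | succ k ih =>
      intro ν hk h1 h2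
      rw [pow_succ] at h1
      rw [pow_succ] at h2
      obtain ⟨h3, h4⟩ := ih (ν / 2) (by omega) (by omega) (by omega)
      have hpos : 1 ≤ ν / 2 := Nat.one_le_two_pow.trans (by omega : 2 ^ k ≤ ν / 2)
      obtain ⟨-, h5, h6⟩ := hq (st (ν / 2)) ((st (ν / 2)).2 - 1) (by omega) h4
      rcases Nat.mod_two_eq_zero_or_one ν with hm | hm
      · rw [show ν = 2 * (ν / 2) by omega, hleft _ hpos]
        exact ⟨by dsimp only; omega, h5⟩
      · rw [show ν = 2 * (ν / 2) + 1 by omega, hright _ hpos]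
        exact ⟨by dsimp only; omega, h6⟩
  have hrule : ∀ ν, 1 ≤ ν → ν < 2 ^ d → S.rule (st ν).1 (st (2 * ν)).1 (st (2 * ν + 1)).1 := by
    intro ν h1 h2
    have hlog : Nat.log 2 ν < d := Nat.log_lt_of_lt_pow (by omega) h2
    obtain ⟨h3, h4⟩ := hinv (Nat.log 2 ν) ν hlog.le (Nat.pow_log_le_self 2 (by omega))
      (Nat.lt_pow_succ_log_self (by norm_num) ν)
    rw [hleft ν h1, hright ν h1]
    exact (hq (st ν) ((st ν).2 - 1) (by omega) h4).1
  have hleaf : ∀ ν, 2 ^ d ≤ ν → ν < 2 ^ (d + 1) → (S.ax (st ν).1).eval α = true := by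
    intro ν h1 h2
    obtain ⟨h3, h4⟩ := hinv d ν le_rfl h1 h2
    rw [show (st ν).2 = 0 by omega] at h4
    exact h4
  set X : ℕ → ℕ := fun ν => S.num (st ν).1 with hX
  let F : ℕ → Finset (Skeleton d (Fintype.card S.Item)) := fun ν =>
    if ν = 0 then rootEdge _ _ (X 1) else nodeEdge _ _ ν (X ν) (X (2 * ν)) (X (2 * ν + 1))
  have hF : ∀ ν v, v ∈ F ν → (v.1.val = 0 ∧ ν = 0) ∨ (v.1.val ≠ 0 ∧ v.1.val / 2 = ν ∧
      v.2.val ≤ 2 * X v.1) ∨ (v.1.val ≠ 0 ∧ v.1.val = ν ∧ 2 * X v.1 + 2 ≤ v.2.val) := by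
    intro ν v hv
    by_cases hν : ν = 0
    · simp only [F, if_pos hν, mem_rootEdge] at hv
      rcases hv with hv | ⟨h1, h2⟩
      · omega
      · rw [h1]; omega
    · simp only [F, if_neg hν, mem_nodeEdge] at hv
      rcases hv with ⟨h1, h2⟩ | ⟨h1, h2⟩ | ⟨h1, h2⟩ <;> rw [h1] <;> omega
  have hF1 : ∀ v : Skeleton d (Fintype.card S.Item), v.1.val ≠ 0 → v.2.val ≤ 2 * X v.1 →
      v ∈ F (v.1.val / 2) := by
    intro v h1 h2
    by_cases hν : v.1.val / 2 = 0
    · have h3 : v.1.val = 1 := by omega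
      rw [h3] at h2
      simp only [F, if_pos hν, mem_rootEdge]
      exact .inr ⟨h3, h2⟩
    · simp only [F, if_neg hν, mem_nodeEdge]
      rcases Nat.mod_two_eq_zero_or_one v.1 with hm | hm
      · have h3 : 2 * (v.1.val / 2) = v.1 := by omega
        rw [h3]; omega
      · have h3 : 2 * (v.1.val / 2) + 1 = v.1 := by omega
        rw [h3]; omega
  have hF2 : ∀ v : Skeleton d (Fintype.card S.Item), v.1.val ≠ 0 → 2 * X v.1 + 2 ≤ v.2.val →
      v ∈ F v.1 := by
    intro v h1 h2
    simp only [F, if_neg h1, mem_nodeEdge]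
    exact .inl ⟨trivial, h2⟩
  refine accepts_toHGP_def.2 ⟨(Finset.range (2 ^ (d + 1))).image F, ?_, ?_, ?_⟩
  · intro e he
    obtain ⟨ν, hν, rfl⟩ := Finset.mem_image.1 he
    refine mem_skeletonEdges.2 ?_
    by_cases h0 : ν = 0
    · refine .inl ?_
      simp only [F, if_pos h0, hX, hst, heapLabel_one]
    · refine .inr ⟨ν, (st ν).1, (st (2 * ν)).1, (st (2 * ν + 1)).1, by omega,
        Finset.mem_range.1 hν, hrule ν (by omega), ?_⟩
      simp only [F, if_neg h0, hX]
  · intro e he e' he' hne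
    obtain ⟨ν, hν, rfl⟩ := Finset.mem_image.1 he
    obtain ⟨μ, hμ, rfl⟩ := Finset.mem_image.1 he'
    refine Finset.disjoint_left.2 fun v h1 h2 => hne ?_
    have h1 := hF ν v h1
    have h2 := hF μ v h2
    rw [show ν = μ by omega]
  · intro v hv
    have h0 : v.1.val ≠ 0 := by
      intro h0
      rw [skeletonLabel, if_pos h0] at hv
      cases hv
    rcases Nat.lt_trichotomy v.2.val (2 * X v.1 + 1) with h | h | h
    · exact ⟨_, Finset.mem_image_of_mem F (Finset.mem_range.2
        ((Nat.div_le_self _ _).trans_lt v.1.2)), hF1 v h0 (Nat.le_of_lt_succ h)⟩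
    · exfalso
      by_cases hd : 2 ^ d ≤ v.1.val
      · rw [skeletonLabel_leaf hd h, hleaf _ hd v.1.2] at hv
        cases hv
      · rw [skeletonLabel, if_neg h0, if_neg (by omega), dif_neg fun h => hd h.1] at hv
        cases hv
    · exact ⟨_, Finset.mem_image_of_mem F (Finset.mem_range.2 v.1.2), hF2 v h0 h⟩

theorem accepts_toHGP_iff {α : Fin n → Bool} :
    (S.toHGP d).Accepts α ↔ S.DerivableInDepth α d S.goal :=
  ⟨derivableInDepth_of_accepts, accepts_of_derivableInDepth⟩

end InferenceSystem

/-! ### Balancing derivations -/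

namespace InferenceSystem

variable {n : ℕ} (S : InferenceSystem n) (α : Fin n → Bool)

/-- `S.Derivable α x s`: there is a derivation tree of `x` with `s` nodes. -/
inductive Derivable : S.Item → ℕ → Prop
  | ax {x : S.Item} : (S.ax x).eval α = true → Derivable x 1
  | rule {x y z : S.Item} {s t : ℕ} :
      S.rule x y z → Derivable y s → Derivable z t → Derivable x (s + t + 1)

/-- `x` follows from `y` and `z`, in either order, by a rule. -/
def SymmRule (x y z : S.Item) : Prop := S.rule x y z ∨ S.rule x z y

/-- `S.DerivableFrom α x y s`: there is a derivation tree of `x`, one of whose leaves is the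
assumption `y`, with `s` nodes besides this leaf. -/
inductive DerivableFrom : S.Item → S.Item → ℕ → Prop
  | refl (x : S.Item) : DerivableFrom x x 0
  | rule {x y z w : S.Item} {s t : ℕ} : S.SymmRule x y z → DerivableFrom y w s →
      S.Derivable α z t → DerivableFrom x w (s + t + 1)

/-- The `j`-th stage of a balanced search for derivations of `x`, without assumptions if `o` is
`none` and from the assumption `y` if `o` is `some y`. A search step guesses the conclusion `v` of
some rule application in the tree and cuts the tree there. -/
def DerivableInStage : ℕ → S.Item → Option S.Item → Prop
  | 0, x, none => (S.ax x).eval α = true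
  | 0, x, some y => x = y
  | j + 1, x, o => DerivableInStage j x o ∨ ∃ v l r, S.SymmRule v l r ∧
      DerivableInStage j x (some v) ∧ DerivableInStage j l o ∧ DerivableInStage j r none

variable {S α}

theorem Derivable.pos {x : S.Item} {s : ℕ} (h : S.Derivable α x s) : 0 < s := by
  cases h <;> omega

theorem SymmRule.derivable {x y z : S.Item} {s t : ℕ} (hr : S.SymmRule x y z)
    (hy : S.Derivable α y s) (hz : S.Derivable α z t) : S.Derivable α x (s + t + 1) := by
  rcases hr with hr | hr
  · exact .rule hr hy hz
  · rw [add_comm s]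
    exact .rule hr hz hy

theorem DerivableInStage.derivable {j : ℕ} {x : S.Item} {o : Option S.Item}
    (h : S.DerivableInStage α j x o) (ho : ∀ y ∈ o, ∃ s, S.Derivable α y s) :
    ∃ s, S.Derivable α x s := by
  induction j generalizing x o with
  | zero =>
    cases o with
    | none => exact ⟨1, .ax h⟩
    | some y =>
      obtain rfl : x = y := h
      exact ho x rfl
  | succ j ih =>
    obtain h | ⟨v, l, r, hr, hx, hl, hr'⟩ := h
    · exact ih h ho
    · refine ih hx ?_
      rintro y ⟨⟩
      obtain ⟨s, hs⟩ := ih hl ho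
      obtain ⟨t, ht⟩ := ih hr' (by simp)
      exact ⟨_, hr.derivable hs ht⟩

theorem DerivableInStage.mono {i j : ℕ} (hij : i ≤ j) {x : S.Item} {o : Option S.Item}
    (h : S.DerivableInStage α i x o) : S.DerivableInStage α j x o := by
  induction hij with
  | refl => exact h
  | step _ ih => exact .inl ih

/-- A derivation tree with more than `τ` nodes has a subtree with more than `τ` nodes whose two
immediate subtrees have at most `τ` nodes. -/
theorem Derivable.exists_split {τ : ℕ} (hτ : 1 ≤ τ) {x : S.Item} {s : ℕ}
    (h : S.Derivable α x s) (hs : τ < s) :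
    ∃ v l r s₁ s₂ s₃, S.SymmRule v l r ∧ S.DerivableFrom α x v s₁ ∧ S.Derivable α l s₂ ∧
      S.Derivable α r s₃ ∧ s₂ ≤ τ ∧ s₃ ≤ τ ∧ s₁ + τ < s := by
  induction h with
  | ax h => omega
  | @rule x y z s t hr hy hz ihy ihz =>
    by_cases hs' : τ < s
    · obtain ⟨v, l, r, s₁, s₂, s₃, hv, hx, hl, hr', h2, h3, h1⟩ := ihy hs'
      exact ⟨v, l, r, _, s₂, s₃, hv, .rule (.inl hr) hx hz, hl, hr', h2, h3, by omega⟩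
    · by_cases ht' : τ < t
      · obtain ⟨v, l, r, s₁, s₂, s₃, hv, hx, hl, hr', h2, h3, h1⟩ := ihz ht'
        exact ⟨v, l, r, _, s₂, s₃, hv, .rule (.inr hr) hx hy, hl, hr', h2, h3, by omega⟩
      · exact ⟨x, y, z, 0, s, t, .inl hr, .refl x, hy, hz, by omega, by omega, by omega⟩

/-- The same for derivations from an assumption, where the cut is made on the branch that leads to
the assumption. There is no control over the size of the subtree that hangs off this branch. -/
theorem DerivableFrom.exists_split {τ : ℕ} {x w : S.Item} {s : ℕ}
    (h : S.DerivableFrom α x w s) (hs : τ < s) :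
    ∃ v l r s₁ s₂ s₃, S.SymmRule v l r ∧ S.DerivableFrom α x v s₁ ∧ S.DerivableFrom α l w s₂ ∧
      S.Derivable α r s₃ ∧ s₂ ≤ τ ∧ s₃ ≤ s ∧ s₁ + τ < s := by
  induction h with
  | refl x => omega
  | @rule x y z w s t hr hy hz ih =>
    by_cases hs' : τ < s
    · obtain ⟨v, l, r, s₁, s₂, s₃, hv, hx, hl, hr', h2, h3, h1⟩ := ih hs'
      exact ⟨v, l, r, _, s₂, s₃, hv, .rule hr hx hz, hl, hr', h2, by omega, by omega⟩
    · exact ⟨x, y, z, 0, s, t, hr, .refl x, hy, hz, by omega, by omega, by omega⟩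

/-- Derivations of size `2 ^ k` are found within `2 * k` stages, and those from an assumption within
one more stage: the cuts of `Derivable.exists_split` halve the size of all parts, and those of
`DerivableFrom.exists_split` halve the size of all parts except for one without assumption, which
needs one stage less. -/
theorem derivableInStage_of_le_two_pow (k : ℕ) :
    (∀ x s, S.Derivable α x s → s ≤ 2 ^ k → S.DerivableInStage α (2 * k) x none) ∧
      ∀ x y s, S.DerivableFrom α x y s → s < 2 ^ k →
        S.DerivableInStage α (2 * k + 1) x (some y) := by
  induction k with
  | zero =>
    constructor
    · intro x s h hs
      cases h with
      | ax h => exact h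
      | rule _ hy hz =>
        have := hy.pos
        omega
    · intro x y s h hs
      cases h with
      | refl => exact .inl rfl
      | rule => omega
  | succ k ih =>
    have hk : 1 ≤ 2 ^ k := Nat.one_le_two_pow
    have hk' : 2 ^ (k + 1) = 2 * 2 ^ k := pow_succ' _ _
    have key : ∀ x s, S.Derivable α x s → s ≤ 2 ^ (k + 1) →
        S.DerivableInStage α (2 * (k + 1)) x none := by
      intro x s h hs
      by_cases hs' : s ≤ 2 ^ k
      · exact (ih.1 x s h hs').mono (by omega)
      · obtain ⟨v, l, r, s₁, s₂, s₃, hv, hx, hl, hr, h2, h3, h1⟩ :=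
          h.exists_split hk (not_le.1 hs')
        exact .inr ⟨v, l, r, hv, ih.2 x v s₁ hx (by omega),
          (ih.1 l s₂ hl h2).mono (Nat.le_succ _), (ih.1 r s₃ hr h3).mono (Nat.le_succ _)⟩
    refine ⟨key, fun x y s h hs => ?_⟩
    by_cases hs' : s < 2 ^ k
    · exact (ih.2 x y s h hs').mono (by omega)
    · obtain ⟨v, l, r, s₁, s₂, s₃, hv, hx, hl, hr, h2, h3, h1⟩ :=
        h.exists_split (τ := 2 ^ k - 1) (by omega)
      exact .inr ⟨v, l, r, hv, (ih.2 x v s₁ hx (by omega)).mono (by omega),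
        (ih.2 l y s₂ hl (by omega)).mono (by omega), key r s₃ hr (by omega)⟩

/-! ### Inference systems as circuits -/

/-- The gates of the circuit that carries out the balanced search. For each stage `j` there are
gates for `DerivableInStage j x o` and, for each candidate for a search step, gates for the
conjunctions of the first two and of all three of its conditions. In addition, there are input gates
below the negated literals. -/
abbrev StageGate (X : Type) (J : ℕ) : Type :=
  (Fin (J + 1) × ((X × Option X) ⊕ (X × X × X × Option X) ⊕ (X × X × X × X × Option X))) ⊕ X

namespace StageGate

variable {X : Type} {J : ℕ}

/-- The gate for `DerivableInStage j x o`. -/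
abbrev stage (j : Fin (J + 1)) (x : X) (o : Option X) : StageGate X J := .inl (j, .inl (x, o))

/-- The gate for `DerivableInStage j x (some v)` and `DerivableInStage j l o`. -/
abbrev pair (j : Fin (J + 1)) (x v l : X) (o : Option X) : StageGate X J :=
  .inl (j, .inr (.inl (x, v, l, o)))

/-- The gate for `DerivableInStage j x (some v)`, `DerivableInStage j l o` and
`DerivableInStage j r none`. -/
abbrev triple (j : Fin (J + 1)) (x v l r : X) (o : Option X) : StageGate X J :=
  .inl (j, .inr (.inr (x, v, l, r, o)))

/-- The wires lead from lower to higher ranks. -/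
def rank : StageGate X J → ℕ
  | .inr _ => 0
  | .inl (j, .inl _) => 3 * j + 1
  | .inl (j, .inr (.inl _)) => 3 * j + 2
  | .inl (j, .inr (.inr _)) => 3 * j + 3

end StageGate

open StageGate

variable (S) in
open Classical in
/-- The inputs of the OR-gate for `DerivableInStage (j + 1) x o`. -/
noncomputable def stageInputs {J : ℕ} (j : Fin (J + 1)) (x : S.Item) (o : Option S.Item) :
    Finset (StageGate S.Item J) :=
  Finset.univ.filter fun g =>
    g = stage j x o ∨ ∃ v l r, S.SymmRule v l r ∧ g = triple j x v l r o

variable (S) in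
open Classical in
/-- The label of the gate for `DerivableInStage j x o`. -/
noncomputable def stageGate {J : ℕ} (j : Fin (J + 1)) (x : S.Item) (o : Option S.Item) :
    Gate n (StageGate S.Item J) :=
  if j.val = 0 then
    match o with
    | some y => .const (decide (x = y))
    | none =>
      match S.ax x with
      | .const b => .const b
      | .var i => .var i
      | .negVar _ => .not (.inr x)
  else .or (S.stageInputs ⟨j - 1, (Nat.sub_le _ _).trans_lt j.2⟩ x o)

variable (S) in
/-- The label of the input gate below the literal `S.ax x`. It matters only for negative
literals. -/
def inputGate (J : ℕ) (x : S.Item) : Gate n (StageGate S.Item J) :=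
  match S.ax x with
  | .negVar i => .var i
  | _ => .const false

variable (S) in
/-- The labels of the gates of the circuit for the balanced search. -/
noncomputable def searchGate (J : ℕ) : StageGate S.Item J → Gate n (StageGate S.Item J)
  | .inr x => S.inputGate J x
  | .inl (j, .inl (x, o)) => S.stageGate j x o
  | .inl (j, .inr (.inl (x, v, l, o))) => .and (stage j x (some v)) (stage j l o)
  | .inl (j, .inr (.inr (x, v, l, r, o))) => .and (pair j x v l o) (stage j r none)

theorem rank_lt_of_mem_inputs {J : ℕ} {a b : StageGate S.Item J}
    (h : a ∈ (S.searchGate J b).inputs) : rank a < rank b := by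
  match b with
  | .inr x =>
    rw [searchGate, inputGate] at h
    cases hx : S.ax x <;> simp [hx, Gate.inputs] at h
  | .inl (j, .inl (x, o)) =>
    rw [searchGate] at h
    unfold stageGate at h
    split_ifs at h with hj
    · match o with
      | some y => simp [Gate.inputs] at h
      | none =>
        cases hx : S.ax x <;> simp [hx, Gate.inputs] at h
        simp [h, rank]
    · simp only [Gate.inputs, stageInputs, Finset.coe_filter, Finset.mem_univ, true_and,
        Set.mem_ofPred_eq] at h
      rcases h with rfl | ⟨v, l, r, -, rfl⟩ <;> simp only [rank] <;> omega
  | .inl (j, .inr (.inl (x, v, l, o))) =>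
    rcases h with rfl | rfl <;> simp [rank]
  | .inl (j, .inr (.inr (x, v, l, r, o))) =>
    rcases h with rfl | rfl <;> simp [rank]

variable (S) in
/-- The circuit that carries out `J` stages of the balanced search for a derivation of the goal. -/
noncomputable abbrev toCircuit (J : ℕ) : Circuit n where
  G := StageGate S.Item J
  gate := S.searchGate J
  acyclic := Subrelation.wf (fun h => rank_lt_of_mem_inputs h) (measure rank).wf
  output := stage (Fin.last J) S.goal none

theorem searchGate_eq_not {J : ℕ} {g a : StageGate S.Item J} (h : S.searchGate J g = .not a) :
    ∃ x i, a = .inr x ∧ S.ax x = .negVar i := by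
  match g with
  | .inr x =>
    rw [searchGate, inputGate] at h
    cases hx : S.ax x <;> simp [hx] at h
  | .inl (j, .inl (x, o)) =>
    rw [searchGate] at h
    unfold stageGate at h
    split_ifs at h with hj
    match o with
    | some y => simp at h
    | none => cases hx : S.ax x <;> simp [hx] at h; exact ⟨x, _, h.symm, hx⟩

theorem notOnlyOnInputs_toCircuit (J : ℕ) : (S.toCircuit J).NotOnlyOnInputs := by
  intro g a h
  obtain ⟨x, i, rfl, hx⟩ := searchGate_eq_not h
  change (S.inputGate J x).IsInput
  rw [inputGate, hx]
  trivial

theorem IsMonotone.toCircuit (hS : S.IsMonotone) (J : ℕ) : (S.toCircuit J).IsMonotone := by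
  intro g a h
  obtain ⟨x, i, -, hx⟩ := searchGate_eq_not h
  exact hS x i hx

theorem size_toCircuit (J : ℕ) : (S.toCircuit J).size =
    (J + 1) * ((Fintype.card S.Item + Fintype.card S.Item ^ 3 + Fintype.card S.Item ^ 4) *
      (Fintype.card S.Item + 1)) + Fintype.card S.Item := by
  change Fintype.card (StageGate S.Item J) = _
  simp only [StageGate, Fintype.card_sum, Fintype.card_prod, Fintype.card_fin,
    Fintype.card_option]
  ring

theorem depthLE_toCircuit (J : ℕ) : (S.toCircuit J).DepthLE (3 * J + 1) := by
  have h : ∀ a b k, (S.toCircuit J).Path a b k →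
      rank (X := S.Item) (J := J) a + k ≤ rank (X := S.Item) (J := J) b := by
    intro a b k hp
    induction hp with
    | refl => simp
    | step _ hw ih =>
      have := rank_lt_of_mem_inputs hw
      omega
  intro a k hp
  have := h _ _ _ hp
  simp only [rank, Fin.val_last] at this
  omega

theorem value_stage (α : Fin n → Bool) {J j : ℕ} (hj : j < J + 1) (x : S.Item)
    (o : Option S.Item) : (S.toCircuit J).value α (stage ⟨j, hj⟩ x o) = true ↔
      S.DerivableInStage α j x o := by
  induction j generalizing x o with
  | zero =>
    have hg : (S.toCircuit J).gate (stage ⟨0, hj⟩ x o) = S.stageGate ⟨0, hj⟩ x o := rfl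
    unfold stageGate at hg
    rw [if_pos rfl] at hg
    match o with
    | some y =>
      rw [Circuit.value_const α hg]
      simp [DerivableInStage]
    | none =>
      rw [DerivableInStage]
      cases hx : S.ax x with
      | const b =>
        rw [hx] at hg
        rw [Circuit.value_const α hg]; rfl
      | var i =>
        rw [hx] at hg
        rw [Circuit.value_var α hg]; rfl
      | negVar i =>
        rw [hx] at hg
        have hi : (S.toCircuit J).gate (.inr x) = .var i := by
          change S.inputGate J x = _
          rw [inputGate, hx]
        rw [Circuit.value_not α hg, Circuit.value_var α hi]; rfl
  | succ j ih =>
    have hj' : j < J + 1 := by omega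
    have hg : (S.toCircuit J).gate (stage ⟨j + 1, hj⟩ x o) = .or (S.stageInputs ⟨j, hj'⟩ x o) := by
      change S.stageGate ⟨j + 1, hj⟩ x o = _
      unfold stageGate
      rw [if_neg (Nat.succ_ne_zero j)]
      rfl
    have htriple : ∀ v l r, (S.toCircuit J).value α (triple ⟨j, hj'⟩ x v l r o) = true ↔
        S.DerivableInStage α j x (some v) ∧ S.DerivableInStage α j l o ∧
          S.DerivableInStage α j r none := by
      intro v l r
      rw [Circuit.value_and α (a := pair ⟨j, hj'⟩ x v l o) (b := stage ⟨j, hj'⟩ r none) rfl,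
        Circuit.value_and α (a := stage ⟨j, hj'⟩ x (some v)) (b := stage ⟨j, hj'⟩ l o) rfl,
        Bool.and_eq_true, Bool.and_eq_true, ih, ih, ih, and_assoc]
    rw [Circuit.value_or α hg, DerivableInStage]
    simp only [stageInputs, Finset.mem_filter, Finset.mem_univ, true_and]
    constructor
    · rintro ⟨g, rfl | ⟨v, l, r, hr, rfl⟩, h⟩
      · exact .inl ((ih _ _ _).1 h)
      · exact .inr ⟨v, l, r, hr, (htriple v l r).1 h⟩
    · rintro (h | ⟨v, l, r, hr, h⟩)
      · exact ⟨_, .inl rfl, (ih _ _ _).2 h⟩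
      · exact ⟨_, .inr ⟨v, l, r, hr, rfl⟩, (htriple v l r).2 h⟩

/-- A system in which the goal, whenever it is derivable, has a derivation of size at most `2 ^ k`
is evaluated by a circuit of depth `O(k)`. -/
theorem value_toCircuit_iff (α : Fin n → Bool) {k : ℕ}
    (h : ∀ s, S.Derivable α S.goal s → ∃ t ≤ 2 ^ k, S.Derivable α S.goal t) :
    (S.toCircuit (2 * k)).value α (S.toCircuit (2 * k)).output = true ↔
      ∃ s, S.Derivable α S.goal s := by
  refine (value_stage α _ _ _).trans ⟨fun h' => h'.derivable (by simp), ?_⟩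
  rintro ⟨s, hs⟩
  obtain ⟨t, ht, ht'⟩ := h s hs
  exact (derivableInStage_of_le_two_pow k).1 _ t ht' ht

end InferenceSystem

/-! ### Tree hypergraph programs as inference systems -/

namespace HGP

variable {n : ℕ} (P : HGP n)

/-- The pieces into which an independent set of hyperedges partitions the set of vertices: vertices
outside of all hyperedges, and hyperedges. The additional piece `none` has no elements; it stands
for the root above all vertices. -/
abbrev Piece : Type := Option (P.V ⊕ {e // e ∈ P.E})

namespace Piece

variable {P}

/-- The vertices of a piece. -/
def verts : P.Piece → Finset P.V
  | none => ∅
  | some (.inl v) => {v}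
  | some (.inr e) => e

/-- The condition under which a piece may be used: a vertex outside of all hyperedges has to have
a true label. -/
def side : P.Piece → VLabel n
  | none => .const true
  | some (.inl v) => P.label v
  | some (.inr _) => .const true

/-- The top element of a piece. -/
def top (tp : {e // e ∈ P.E} → P.V) : P.Piece → Option P.V
  | none => none
  | some (.inl v) => some v
  | some (.inr e) => some (tp e)

/-- The elements just below a piece. -/
def IsBelow (par : P.V → Option P.V) (p : P.Piece) (v : P.V) : Prop :=
  v ∉ p.verts ∧ match par v with
    | none => p = none
    | some u => u ∈ p.verts

open Classical in
/-- The set of elements just below a piece. -/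
noncomputable def below (par : P.V → Option P.V) (p : P.Piece) : Finset P.V :=
  Finset.univ.filter (p.IsBelow par)

end Piece

variable (par : P.V → Option P.V) (tp : {e // e ∈ P.E} → P.V)

/-- The position of a vertex in an arbitrary enumeration of the vertices. -/
noncomputable def idx (v : P.V) : Fin (Fintype.card P.V) := Fintype.equivFin P.V v

/-- The inference system that looks for a partition of the set of vertices into pieces. The item
`(p, i)` says that the piece `p` may be used and that what hangs below the elements of
`p.below par` in positions less than `i` can be partitioned into pieces. -/
noncomputable def toInferenceSystem : InferenceSystem n where
  Item := P.Piece × Fin (Fintype.card P.V + 1)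
  rule x y z := ∃ v, x.2 = (P.idx v).succ ∧ y = (x.1, (P.idx v).castSucc) ∧
    ((v ∈ x.1.below par ∧ ∃ q : P.Piece, q.top tp = some v ∧ z = (q, Fin.last _)) ∨
      (v ∉ x.1.below par ∧ z = (none, 0)))
  ax x := if x.2 = 0 then x.1.side else .const false
  goal := (none, Fin.last _)

variable {P par tp}

theorem IsMonotone.toInferenceSystem (hP : P.IsMonotone) :
    (P.toInferenceSystem par tp).IsMonotone := by
  rintro ⟨p, j⟩ i h
  simp only [HGP.toInferenceSystem] at h
  split_ifs at h
  match p with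
  | none => simp [Piece.side] at h
  | some (.inl v) => exact hP v i h
  | some (.inr e) => simp [Piece.side] at h

theorem card_item_toInferenceSystem : Fintype.card (P.toInferenceSystem par tp).Item =
    (P.size + 1) * (Fintype.card P.V + 1) := by
  change Fintype.card (P.Piece × Fin (Fintype.card P.V + 1)) = _
  simp [HGP.size]

theorem Piece.mem_below {p : P.Piece} {v : P.V} : v ∈ p.below par ↔ p.IsBelow par v := by
  simp [Piece.below]

theorem Piece.mem_below_of_par_eq_some {p : P.Piece} {v u : P.V} (h : par v = some u) :
    v ∈ p.below par ↔ v ∉ p.verts ∧ u ∈ p.verts := by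
  rw [mem_below, IsBelow, h]

theorem Piece.mem_below_of_par_eq_none {p : P.Piece} {v : P.V} (h : par v = none) :
    v ∈ p.below par ↔ p = none := by
  rw [mem_below, IsBelow, h, and_iff_right_iff_imp]
  rintro rfl
  simp [verts]

section Rooted

variable {rank : P.V → ℕ} (hpar : ∀ v u, par v = some u → rank u < rank v)
  (htp : ∀ e, tp e ∈ e.1) (htop : ∀ e, ∀ v ∈ e.1, v ≠ tp e → ∃ u ∈ e.1, par v = some u)

include htp in
theorem Piece.mem_verts_of_top {p : P.Piece} {t : P.V} (h : p.top tp = some t) :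
    t ∈ p.verts := by
  match p with
  | none => simp [top] at h
  | some (.inl v) =>
    obtain rfl := Option.some.inj h
    exact Finset.mem_singleton_self v
  | some (.inr e) =>
    obtain rfl := Option.some.inj h
    exact htp e

include htop in
theorem Piece.top_or_par_mem {p : P.Piece} {v : P.V} (h : v ∈ p.verts) :
    p.top tp = some v ∨ ∃ u ∈ p.verts, par v = some u := by
  match p with
  | none => simp [verts] at h
  | some (.inl w) =>
    obtain rfl := Finset.mem_singleton.1 h
    exact .inl rfl
  | some (.inr e) =>
    by_cases hv : v = tp e
    · exact .inl (congrArg some hv.symm)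
    · exact .inr (htop e v h hv)

include hpar htop in
theorem Piece.rank_top_le {p : P.Piece} {t v : P.V} (ht : p.top tp = some t)
    (h : v ∈ p.verts) : rank t ≤ rank v := by
  refine TreeHP.rank_top_le (e := (p.verts : Set P.V)) hpar (fun w hw hwt => ?_) h
  refine (Piece.top_or_par_mem htop hw).resolve_left fun hw' => hwt ?_
  exact Option.some.inj (hw'.symm.trans ht)

/-! ### From derivations to independent covers -/

/-- What the derivability of an item `(p, i)` says about the piece `p`. -/
theorem piece_of_derivable {α : Fin n → Bool} {p : P.Piece} {i : Fin (Fintype.card P.V + 1)}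
    {s : ℕ} (h : (P.toInferenceSystem par tp).Derivable α (p, i) s) :
    p.side.eval α = true ∧ ∀ v ∈ p.below par, (P.idx v).val < i.val →
      ∃ q : P.Piece, q.top tp = some v ∧
        ∃ t, (P.toInferenceSystem par tp).Derivable α (q, Fin.last _) t := by
  obtain ⟨x, hx⟩ : ∃ x : (P.toInferenceSystem par tp).Item, x = (p, i) := ⟨_, rfl⟩
  rw [← hx] at h
  induction h generalizing p i with
  | @ax x h =>
    subst hx
    simp only [HGP.toInferenceSystem] at h
    split_ifs at h with h0
    · refine ⟨h, fun v _ hv => ?_⟩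
      rw [h0] at hv
      exact absurd hv (Nat.not_lt_zero _)
    · simp [VLabel.eval] at h
  | @rule x y z s t hr hy hz ihy ihz =>
    subst hx
    obtain ⟨w, hi, rfl, hw⟩ := hr
    obtain ⟨h1, h2⟩ := ihy rfl
    refine ⟨h1, fun v hv hvi => ?_⟩
    dsimp only at hi
    rw [hi, Fin.val_succ, Nat.lt_succ_iff_lt_or_eq] at hvi
    rcases hvi with hvi | hvi
    · exact h2 v hv hvi
    · obtain rfl : v = w := (Fintype.equivFin P.V).injective (Fin.ext hvi)
      obtain ⟨-, q, hq, rfl⟩ := hw.resolve_right fun h => h.1 hv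
      exact ⟨q, hq, t, hz⟩

/-- The pieces obtained from the root by using, for each element below a piece obtained so far, the
piece that `c` assigns to this element. -/
inductive Chosen (par : P.V → Option P.V) (c : P.V → P.Piece) : P.Piece → Prop
  | root : Chosen par c none
  | step {p : P.Piece} {v : P.V} : Chosen par c p → v ∈ p.below par → Chosen par c (c v)

include hpar htp in
/-- The chosen pieces cover all vertices. -/
theorem Chosen.exists_mem {c : P.V → P.Piece}
    (hc : ∀ p v, Chosen par c p → v ∈ p.below par → (c v).top tp = some v) (u : P.V) :
    ∃ p, Chosen par c p ∧ u ∈ p.verts := by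
  induction hr : rank u using Nat.strong_induction_on generalizing u with
  | _ r ih =>
    suffices h : ∀ p, Chosen par c p → u ∈ p.below par → ∃ p, Chosen par c p ∧ u ∈ p.verts by
      cases hu : par u with
      | none => exact h none .root ((Piece.mem_below_of_par_eq_none hu).2 rfl)
      | some w =>
        obtain ⟨p, hp, hw⟩ := ih _ (hr ▸ hpar u w hu) w rfl
        by_cases hup : u ∈ p.verts
        · exact ⟨p, hp, hup⟩
        · exact h p hp ((Piece.mem_below_of_par_eq_some hu).2 ⟨hup, hw⟩)
    exact fun p hp hu => ⟨c u, .step hp hu, Piece.mem_verts_of_top htp (hc p u hp hu)⟩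

include hpar htop in
/-- The chosen pieces are pairwise disjoint. -/
theorem Chosen.eq_of_mem {c : P.V → P.Piece}
    (hc : ∀ p v, Chosen par c p → v ∈ p.below par → (c v).top tp = some v) (u : P.V)
    {p q : P.Piece} (hp : Chosen par c p) (hq : Chosen par c q) (hup : u ∈ p.verts)
    (huq : u ∈ q.verts) : p = q := by
  induction hr : rank u using Nat.strong_induction_on generalizing u p q with
  | _ r ih =>
    -- A chosen piece with top element `u` is `c u`, and was chosen because of a piece above `u`.
    have htop' : ∀ p, Chosen par c p → p.top tp = some u →
        p = c u ∧ ∃ p', Chosen par c p' ∧ u ∈ p'.below par := by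
      rintro p (_ | @⟨p', v, hp', hv⟩) hpu
      · simp [Piece.top] at hpu
      · obtain rfl : v = u := Option.some.inj ((hc p' v hp' hv).symm.trans hpu)
        exact ⟨rfl, p', hp', hv⟩
    have key : ∀ p q, Chosen par c p → Chosen par c q → u ∈ q.verts → p.top tp = some u →
        ∀ w ∈ q.verts, par u ≠ some w := by
      intro p q hp hq huq hpt w hw huw
      obtain ⟨-, p', hp', hup'⟩ := htop' p hp hpt
      rw [Piece.mem_below_of_par_eq_some huw] at hup'
      obtain rfl := ih _ (hr ▸ hpar u w huw) w hp' hq hup'.2 hw rfl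
      exact hup'.1 huq
    rcases Piece.top_or_par_mem htop hup with hpt | ⟨w, hw, huw⟩ <;>
      rcases Piece.top_or_par_mem htop huq with hqt | ⟨w', hw', huw'⟩
    · rw [(htop' p hp hpt).1, (htop' q hq hqt).1]
    · exact absurd huw' (key p q hp hq huq hpt w' hw')
    · exact absurd huw (key q p hq hp hup hqt w hw)
    · obtain rfl := Option.some.inj (huw.symm.trans huw')
      exact ih _ (hr ▸ hpar u w huw) w hp hq hw hw' rfl

include hpar htp htop in
theorem accepts_of_derivable {α : Fin n → Bool} {s : ℕ}
    (h : (P.toInferenceSystem par tp).Derivable α (P.toInferenceSystem par tp).goal s) :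
    P.Accepts α := by
  classical
  have hex : ∀ v, ∃ q : P.Piece,
      (∃ q : P.Piece, q.top tp = some v ∧
        ∃ t, (P.toInferenceSystem par tp).Derivable α (q, Fin.last _) t) →
      q.top tp = some v ∧ ∃ t, (P.toInferenceSystem par tp).Derivable α (q, Fin.last _) t := by
    intro v
    by_cases hv : ∃ q : P.Piece, q.top tp = some v ∧
        ∃ t, (P.toInferenceSystem par tp).Derivable α (q, Fin.last _) t
    · exact hv.imp fun q hq _ => hq
    · exact ⟨none, fun h => absurd h hv⟩
  choose c hc using hex
  have hder : ∀ p, Chosen par c p →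
      ∃ t, (P.toInferenceSystem par tp).Derivable α (p, Fin.last _) t := by
    intro p hp
    induction hp with
    | root => exact ⟨s, h⟩
    | step _ hv ih =>
      obtain ⟨t, ht⟩ := ih
      exact (hc _ ((piece_of_derivable ht).2 _ hv (Fin.is_lt _))).2
  have hctop : ∀ p v, Chosen par c p → v ∈ p.below par → (c v).top tp = some v := by
    intro p v hp hv
    obtain ⟨t, ht⟩ := hder p hp
    exact (hc _ ((piece_of_derivable ht).2 _ hv (Fin.is_lt _))).1
  refine ⟨P.E.filter fun e => ∃ he : e ∈ P.E, Chosen par c (some (.inr ⟨e, he⟩)),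
    Finset.filter_subset _ _, ?_, ?_⟩
  · intro e he e' he' hne
    obtain ⟨-, he, hce⟩ := Finset.mem_filter.1 he
    obtain ⟨-, he', hce'⟩ := Finset.mem_filter.1 he'
    refine Finset.disjoint_left.2 fun v hv hv' => hne ?_
    have := Chosen.eq_of_mem hpar htop hctop v hce hce' hv hv'
    simpa using this
  · intro v hv
    obtain ⟨p, hp, hvp⟩ := Chosen.exists_mem hpar htp hctop v
    match p with
    | none => simp [Piece.verts] at hvp
    | some (.inl w) =>
      obtain rfl := Finset.mem_singleton.1 hvp
      obtain ⟨t, ht⟩ := hder _ hp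
      have := (piece_of_derivable ht).1
      rw [Piece.side, hv] at this
      cases this
    | some (.inr e) => exact ⟨e, Finset.mem_filter.2 ⟨e.2, e.2, hp⟩, hvp⟩

/-! ### From independent covers to small derivations -/

open Classical in
/-- The elements below `v` in the rooted tree, including `v`. -/
noncomputable def descendants (par : P.V → Option P.V) (v : P.V) : Finset P.V :=
  Finset.univ.filter fun u => Relation.ReflTransGen (fun a b => par a = some b) u v

theorem mem_descendants {u v : P.V} : u ∈ descendants par v ↔
    Relation.ReflTransGen (fun a b => par a = some b) u v := by
  simp [descendants]

include hpar in
theorem rank_le_of_reflTransGen {u v : P.V}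
    (h : Relation.ReflTransGen (fun a b => par a = some b) u v) : rank v ≤ rank u := by
  induction h with
  | refl => exact le_rfl
  | tail _ h ih => exact (hpar _ _ h).le.trans ih

include hpar htop in
theorem Piece.reflTransGen_top {p : P.Piece} {t u : P.V} (ht : p.top tp = some t)
    (hu : u ∈ p.verts) : Relation.ReflTransGen (fun a b => par a = some b) u t := by
  induction hr : rank u using Nat.strong_induction_on generalizing u with
  | _ r ih =>
    rcases Piece.top_or_par_mem htop hu with h | ⟨w, hw, huw⟩
    · obtain rfl := Option.some.inj (h.symm.trans ht)
      exact .refl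
    · exact .head huw (ih _ (hr ▸ hpar u w huw) hw rfl)

include hpar htop in
/-- Going up from a piece, one leaves it through its top element. -/
theorem Piece.mem_or_rank_lt {p : P.Piece} {x y : P.V} (hx : x ∈ p.verts)
    (h : Relation.ReflTransGen (fun a b => par a = some b) x y) :
    y ∈ p.verts ∨ ∃ t, p.top tp = some t ∧ rank y < rank t := by
  induction h with
  | refl => exact .inl hx
  | @tail y z _ h ih =>
    rcases ih with hy | ⟨t, ht, hlt⟩
    · rcases Piece.top_or_par_mem htop hy with ht | ⟨w, hw, hyw⟩
      · exact .inr ⟨y, ht, hpar _ _ h⟩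
      · obtain rfl := Option.some.inj (hyw.symm.trans h)
        exact .inl hw
    · exact .inr ⟨t, ht, (hpar _ _ h).trans hlt⟩

include hpar htop in
/-- No element just below a piece lies above another one. -/
theorem Piece.eq_of_mem_below {p : P.Piece} {v w : P.V} (hv : v ∈ p.below par)
    (hw : w ∈ p.below par) (h : Relation.ReflTransGen (fun a b => par a = some b) v w) :
    v = w := by
  rcases Relation.ReflTransGen.cases_head h with h | ⟨x, hvx, hxw⟩
  · exact h
  · exfalso
    have hx := ((Piece.mem_below_of_par_eq_some hvx).1 hv).2
    cases hy : par w with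
    | none =>
      obtain rfl := (Piece.mem_below_of_par_eq_none hy).1 hw
      simp [verts] at hx
    | some y =>
      obtain ⟨hwp, hyp⟩ := (Piece.mem_below_of_par_eq_some hy).1 hw
      obtain ⟨t, ht, hlt⟩ := (Piece.mem_or_rank_lt hpar htop hx hxw).resolve_left hwp
      have := Piece.rank_top_le hpar htop ht hyp
      have := hpar w y hy
      omega

include hpar htop in
theorem Piece.pairwiseDisjoint_descendants (p : P.Piece) :
    (p.below par : Set P.V).PairwiseDisjoint (descendants par) := by
  intro v hv w hw hvw
  refine Finset.disjoint_left.2 fun u hu hu' => hvw ?_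
  rw [mem_descendants] at hu hu'
  have huniq : Relator.RightUnique fun a b : P.V => par a = some b :=
    fun a b c hb hc => Option.some.inj (hb.symm.trans hc)
  rcases Relation.ReflTransGen.total_of_right_unique huniq hu hu' with h | h
  · exact Piece.eq_of_mem_below hpar htop hv hw h
  · exact (Piece.eq_of_mem_below hpar htop hw hv h).symm

include hpar htop in
theorem Piece.sum_card_descendants_le (p : P.Piece) :
    ∑ v ∈ p.below par, (descendants par v).card ≤ Fintype.card P.V := by
  classical
  rw [← Finset.card_biUnion (Piece.pairwiseDisjoint_descendants hpar htop p)]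
  exact Finset.card_le_univ _

include hpar htop in
theorem Piece.sum_card_descendants_lt {p : P.Piece} {t : P.V} (ht : p.top tp = some t) :
    ∑ v ∈ p.below par, (descendants par v).card < (descendants par t).card := by
  classical
  rw [← Finset.card_biUnion (Piece.pairwiseDisjoint_descendants hpar htop p)]
  have hbelow : ∀ v ∈ p.below par, ∃ u ∈ p.verts, par v = some u := by
    intro v hv
    cases hu : par v with
    | none =>
      obtain rfl := (Piece.mem_below_of_par_eq_none hu).1 hv
      simp [top] at ht
    | some u => exact ⟨u, ((Piece.mem_below_of_par_eq_some hu).1 hv).2, rfl⟩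
  refine Finset.card_lt_card ((Finset.ssubset_iff_of_subset ?_).2
    ⟨t, mem_descendants.2 .refl, ?_⟩)
  · intro u hu
    obtain ⟨v, hv, huv⟩ := Finset.mem_biUnion.1 hu
    obtain ⟨x, hx, hvx⟩ := hbelow v hv
    exact mem_descendants.2 ((mem_descendants.1 huv).trans
      (.head hvx (Piece.reflTransGen_top hpar htop ht hx)))
  · intro h
    obtain ⟨v, hv, htv⟩ := Finset.mem_biUnion.1 h
    obtain ⟨x, hx, hvx⟩ := hbelow v hv
    have h1 := rank_le_of_reflTransGen hpar (mem_descendants.1 htv)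
    have h2 := Piece.rank_top_le hpar htop ht hx
    have h3 := hpar v x hvx
    omega

/-- Derivations for pieces below `p`, one with each element of `p.below par` as its top, combine
into a derivation for `p` whose size is the sum of their sizes up to a term linear in the number of
vertices. -/
theorem derivable_of_below {α : Fin n → Bool} {p : P.Piece} (hp : p.side.eval α = true)
    {B : P.V → ℕ} (hB : ∀ v ∈ p.below par, ∃ q : P.Piece, q.top tp = some v ∧
      ∃ t ≤ B v, (P.toInferenceSystem par tp).Derivable α (q, Fin.last _) t) :
    ∃ s ≤ 2 * Fintype.card P.V + 1 + ∑ v ∈ p.below par, B v,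
      (P.toInferenceSystem par tp).Derivable α (p, Fin.last _) s := by
  classical
  have key : ∀ i (hi : i < Fintype.card P.V + 1),
      ∃ s ≤ 2 * i + 1 + ∑ v ∈ (p.below par).filter (fun v => (P.idx v).val < i), B v,
        (P.toInferenceSystem par tp).Derivable α (p, ⟨i, hi⟩) s := by
    intro i
    induction i with
    | zero => exact fun _ => ⟨1, by omega, .ax hp⟩
    | succ i ih =>
      intro hi
      obtain ⟨s, hs, hd⟩ := ih (by omega)
      obtain ⟨v, hv⟩ : ∃ v, P.idx v = ⟨i, by omega⟩ :=
        ⟨(Fintype.equivFin P.V).symm _, Equiv.apply_symm_apply _ _⟩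
      have hvi : (P.idx v).val = i := by rw [hv]
      by_cases hvp : v ∈ p.below par
      · obtain ⟨q, hq, t, ht, hqt⟩ := hB v hvp
        refine ⟨s + t + 1, ?_, .rule ⟨v, by rw [hv]; rfl, rfl, .inl ⟨hvp, q, hq, rfl⟩⟩
          (by rw [hv]; exact hd) hqt⟩
        have hins : (p.below par).filter (fun w => (P.idx w).val < i + 1) =
            insert v ((p.below par).filter fun w => (P.idx w).val < i) := by
          ext w
          simp only [Finset.mem_filter, Finset.mem_insert, Nat.lt_succ_iff_lt_or_eq]
          constructor
          · rintro ⟨h1, h2 | h2⟩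
            · exact .inr ⟨h1, h2⟩
            · exact .inl ((Fintype.equivFin P.V).injective (Fin.ext (h2.trans hvi.symm)))
          · rintro (rfl | ⟨h1, h2⟩)
            · exact ⟨hvp, .inr hvi⟩
            · exact ⟨h1, .inl h2⟩
        rw [hins, Finset.sum_insert (by simp [hvi])]
        omega
      · refine ⟨s + 1 + 1, ?_, .rule ⟨v, by rw [hv]; rfl, rfl, .inr ⟨hvp, rfl⟩⟩
          (by rw [hv]; exact hd) (.ax rfl)⟩
        have hle : ∑ v ∈ (p.below par).filter (fun v => (P.idx v).val < i), B v ≤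
            ∑ v ∈ (p.below par).filter (fun v => (P.idx v).val < i + 1), B v :=
          Finset.sum_le_sum_of_subset (Finset.monotone_filter_right _ fun w _ h =>
            Nat.lt_succ_of_lt h)
        omega
  obtain ⟨s, hs, hd⟩ := key (Fintype.card P.V) (Nat.lt_succ_self _)
  refine ⟨s, hs.trans (Nat.add_le_add_left ?_ _), hd⟩
  exact Finset.sum_le_sum_of_subset (Finset.filter_subset _ _)

include hpar htop in
theorem exists_derivable_of_accepts {α : Fin n → Bool} (h : P.Accepts α) :
    ∃ s ≤ (2 * Fintype.card P.V + 1) * (Fintype.card P.V + 1),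
      (P.toInferenceSystem par tp).Derivable α (P.toInferenceSystem par tp).goal s := by
  obtain ⟨E', hE, hdisj, hcov⟩ := h
  -- The pieces of the partition given by `E'`.
  let good : P.Piece → Prop
    | none => False
    | some (.inl v) => ∀ e ∈ E', v ∉ e
    | some (.inr e) => e.1 ∈ E'
  have hgood : ∀ v, ∃ q, good q ∧ v ∈ q.verts := by
    intro v
    by_cases hv : ∃ e ∈ E', v ∈ e
    · obtain ⟨e, he, hve⟩ := hv
      exact ⟨some (.inr ⟨e, hE he⟩), he, hve⟩
    · push Not at hv
      exact ⟨some (.inl v), hv, Finset.mem_singleton_self v⟩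
  have heq : ∀ p q v, good p → good q → v ∈ p.verts → v ∈ q.verts → p = q := by
    intro p q v hp hq hvp hvq
    match p, q with
    | none, _ => exact hp.elim
    | _, none => exact hq.elim
    | some (.inl a), some (.inl b) =>
      rw [← Finset.mem_singleton.1 hvp, ← Finset.mem_singleton.1 hvq]
    | some (.inl a), some (.inr e) =>
      obtain rfl := Finset.mem_singleton.1 hvp
      exact absurd hvq (hp _ hq)
    | some (.inr e), some (.inl a) =>
      obtain rfl := Finset.mem_singleton.1 hvq
      exact absurd hvp (hq _ hp)
    | some (.inr e), some (.inr e') =>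
      by_cases hee : e.1 = e'.1
      · rw [Subtype.ext hee]
      · exact absurd hvq (Finset.disjoint_left.1 (hdisj _ hp _ hq hee) hvp)
  have hbelow : ∀ (p : P.Piece) v, (p = none ∨ good p) → v ∈ p.below par →
      ∃ q, good q ∧ q.top tp = some v := by
    intro p v hp hv
    obtain ⟨q, hq, hvq⟩ := hgood v
    refine ⟨q, hq, (Piece.top_or_par_mem htop hvq).resolve_right ?_⟩
    rintro ⟨w, hw, hvw⟩
    obtain ⟨hvp, hwp⟩ := (Piece.mem_below_of_par_eq_some hvw).1 hv
    rcases hp with rfl | hp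
    · simp [Piece.verts] at hwp
    · exact hvp (heq q p w hq hp hw hwp ▸ hvq)
  have hside : ∀ p : P.Piece, good p → p.side.eval α = true := by
    intro p hp
    match p with
    | none => exact hp.elim
    | some (.inr e) => rfl
    | some (.inl v) =>
      change (P.label v).eval α = true
      rw [← Bool.not_eq_false]
      intro hv
      obtain ⟨e, he, hve⟩ := hcov v hv
      exact hp e he hve
  have hder : ∀ m (p : P.Piece) v, (descendants par v).card = m → good p → p.top tp = some v →
      ∃ s ≤ (2 * Fintype.card P.V + 1) * (descendants par v).card,
        (P.toInferenceSystem par tp).Derivable α (p, Fin.last _) s := by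
    intro m
    induction m using Nat.strong_induction_on with
    | _ m ih =>
      intro p v hm hp hpv
      have hlt := Piece.sum_card_descendants_lt hpar htop hpv
      obtain ⟨s, hs, hd⟩ := derivable_of_below (par := par) (tp := tp) (hside p hp)
        (B := fun w => (2 * Fintype.card P.V + 1) * (descendants par w).card) fun w hw => by
          obtain ⟨q, hq, hqw⟩ := hbelow p w (.inr hp) hw
          refine ⟨q, hqw, ih _ (hm ▸ lt_of_le_of_lt ?_ hlt) q w rfl hq hqw⟩
          exact Finset.single_le_sum (f := fun w => (descendants par w).card)
            (fun _ _ => Nat.zero_le _) hw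
      refine ⟨s, hs.trans ?_, hd⟩
      rw [← Finset.mul_sum, add_comm, ← Nat.mul_succ]
      exact Nat.mul_le_mul_left _ hlt
  obtain ⟨s, hs, hd⟩ := derivable_of_below (par := par) (tp := tp) (α := α) (p := none) rfl
    (B := fun w => (2 * Fintype.card P.V + 1) * (descendants par w).card) fun w hw => by
      obtain ⟨q, hq, hqw⟩ := hbelow none w (.inl rfl) hw
      exact ⟨q, hqw, hder _ q w rfl hq hqw⟩
  refine ⟨s, hs.trans ?_, hd⟩
  rw [← Finset.mul_sum, add_comm, ← Nat.mul_succ]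
  exact Nat.mul_le_mul_left _ (Nat.succ_le_succ (Piece.sum_card_descendants_le hpar htop none))

end Rooted

end HGP

/-! ### The two simulations -/

/-- The size of the program is exponential in the depth of the circuit, which is harmless for depth
`O(log n)`. -/
theorem Circuit.exists_hgp {n : ℕ} {C : Circuit n} (hC : C.NotOnlyOnInputs)
    {f : (Fin n → Bool) → Bool} (hf : C.Computes f) {d : ℕ} (hd : C.DepthLE d) {a : ℕ}
    (ha : C.size ≤ 2 ^ a) :
    ∃ P : HGP n, P.IsTHGP ∧ P.Computes f ∧ P.size ≤ 2 ^ (d + 3 * a + 8) ∧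
      (C.IsMonotone → P.IsMonotone) := by
  refine ⟨C.toInferenceSystem.toHGP d, InferenceSystem.isTHGP_toHGP, fun α => ?_, ?_,
    fun h => (h.toInferenceSystem).toHGP⟩
  · rw [InferenceSystem.accepts_toHGP_iff, Circuit.derivableInDepth_goal_iff hC hd, hf]
  · have hcard : Fintype.card C.toInferenceSystem.Item = C.size + 1 := Fintype.card_option
    have hN : Fintype.card C.toInferenceSystem.Item ≤ 2 ^ (a + 1) := by
      have := Nat.one_le_two_pow (n := a)
      rw [hcard, pow_succ]
      omega
    refine InferenceSystem.size_toHGP_le.trans ?_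
    generalize Fintype.card C.toInferenceSystem.Item = N at hN
    calc 2 ^ (d + 1) * (2 * N + 1) + (2 ^ (d + 1) * N ^ 3 + 1)
        ≤ 2 ^ (d + 1) * (2 * 2 ^ (a + 1) + 1) + (2 ^ (d + 1) * (2 ^ (a + 1)) ^ 3 + 1) := by
          gcongr
      _ = 2 ^ d * (8 * 2 ^ a + 16 * (2 ^ a) ^ 3 + 2) + 1 := by ring
      _ ≤ 2 ^ d * (8 * (2 ^ a) ^ 3 + 16 * (2 ^ a) ^ 3 + 2 * (2 ^ a) ^ 3) +
            2 ^ d * (2 ^ a) ^ 3 := by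
          have h1 : 1 ≤ 2 ^ a := Nat.one_le_two_pow
          have h2 : 1 ≤ (2 ^ a) ^ 3 := Nat.one_le_pow _ _ h1
          have h3 : 2 ^ a ≤ (2 ^ a) ^ 3 := Nat.le_self_pow (by norm_num) _
          have h4 : 1 ≤ 2 ^ d := Nat.one_le_two_pow
          have h5 := Nat.mul_le_mul h4 h2
          gcongr
          omega
      _ = 27 * (2 ^ d * (2 ^ a) ^ 3) := by ring
      _ ≤ 256 * (2 ^ d * (2 ^ a) ^ 3) := by gcongr; norm_num
      _ = 2 ^ (d + 3 * a + 8) := by ring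

/-- The circuit has a size polynomial in the bound `2 ^ a` for the size of the program, and a depth
logarithmic in it. -/
theorem HGP.exists_circuit {n : ℕ} {P : HGP n} (hP : P.IsTHGP) {f : (Fin n → Bool) → Bool}
    (hf : P.Computes f) {a : ℕ} (ha : P.size ≤ 2 ^ a) :
    ∃ C : Circuit n, C.NotOnlyOnInputs ∧ C.Computes f ∧ C.size ≤ 2 ^ (14 * a + 20) ∧
      C.DepthLE (12 * a + 19) ∧ (P.IsMonotone → C.IsMonotone) := by
  obtain ⟨par, rank, hpar, hE⟩ := hP.exists_par
  have hE' : ∀ e : {e // e ∈ P.E}, ∃ t ∈ e.1, ∀ v ∈ e.1, v ≠ t → ∃ u ∈ e.1, par v = some u :=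
    fun e => hE e.1 e.2
  choose tp htp htop using hE'
  have hV : Fintype.card P.V ≤ 2 ^ a := (Nat.le_add_right _ _).trans ha
  have h1 : 1 ≤ 2 ^ a := Nat.one_le_two_pow
  set S := P.toInferenceSystem par tp with hS
  have hcard : Fintype.card S.Item ≤ 2 ^ (2 * a + 2) := by
    rw [hS, HGP.card_item_toInferenceSystem]
    calc (P.size + 1) * (Fintype.card P.V + 1) ≤ (2 * 2 ^ a) * (2 * 2 ^ a) := by
          gcongr <;> omega
      _ = 2 ^ (2 * a + 2) := by ring
  have hsmall : (2 * Fintype.card P.V + 1) * (Fintype.card P.V + 1) ≤ 2 ^ (2 * a + 3) := by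
    calc (2 * Fintype.card P.V + 1) * (Fintype.card P.V + 1) ≤ (4 * 2 ^ a) * (2 * 2 ^ a) := by
          gcongr <;> omega
      _ = 2 ^ (2 * a + 3) := by ring
  refine ⟨S.toCircuit (2 * (2 * a + 3)), InferenceSystem.notOnlyOnInputs_toCircuit _,
    fun α => ?_, ?_, ?_, fun h => (h.toInferenceSystem).toCircuit _⟩
  · rw [Bool.eq_iff_iff, hf α, InferenceSystem.value_toCircuit_iff]
    · refine ⟨fun ⟨s, hs⟩ => HGP.accepts_of_derivable hpar htp htop hs, fun h => ?_⟩
      obtain ⟨s, -, hs⟩ := HGP.exists_derivable_of_accepts hpar htop h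
      exact ⟨s, hs⟩
    · intro s hs
      obtain ⟨t, ht, hd⟩ := HGP.exists_derivable_of_accepts hpar htop
        (HGP.accepts_of_derivable hpar htp htop hs)
      exact ⟨t, ht.trans hsmall, hd⟩
  · rw [InferenceSystem.size_toCircuit]
    generalize Fintype.card S.Item = N at hcard
    have h2 : 1 ≤ 2 ^ (2 * a + 2) := Nat.one_le_two_pow
    have hJ : 2 * (2 * a + 3) + 1 ≤ 2 ^ (2 * (2 * a + 3)) := Nat.lt_two_pow_self
    generalize hM : 2 ^ (2 * a + 2) = M at hcard h2
    have h3 : N + N ^ 3 + N ^ 4 ≤ 3 * M ^ 4 := by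
      have e1 : N ≤ M ^ 4 := hcard.trans (Nat.le_self_pow (by norm_num) _)
      have e2 : N ^ 3 ≤ M ^ 4 :=
        (Nat.pow_le_pow_left hcard 3).trans (Nat.pow_le_pow_right h2 (by norm_num))
      have e3 : N ^ 4 ≤ M ^ 4 := Nat.pow_le_pow_left hcard 4
      omega
    calc (2 * (2 * a + 3) + 1) * ((N + N ^ 3 + N ^ 4) * (N + 1)) + N
        ≤ 2 ^ (2 * (2 * a + 3)) * ((3 * M ^ 4) * (2 * M)) +
            2 ^ (2 * (2 * a + 3)) * (2 * M ^ 5) := by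
          gcongr ?_ * (?_ * ?_) + ?_
          · omega
          · have e1 : 1 ≤ 2 ^ (2 * (2 * a + 3)) := Nat.one_le_two_pow
            have e2 : M ≤ M ^ 5 := Nat.le_self_pow (by norm_num) _
            have e3 := Nat.mul_le_mul e1 (hcard.trans (e2.trans (Nat.le_mul_of_pos_left _ two_pos)))
            omega
      _ = 512 * ((2 ^ a) ^ 4 * M ^ 5) := by ring
      _ ≤ 1024 * ((2 ^ a) ^ 4 * M ^ 5) := by gcongr; norm_num
      _ = 2 ^ (14 * a + 20) := by rw [← hM]; ring
  · convert InferenceSystem.depthLE_toCircuit (S := S) (2 * (2 * a + 3)) using 1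
    ring

theorem exists_hgps_of_circuits {f : BoolFunSeq} {C : (n : ℕ) → Circuit n}
    (hC : ∀ n, (C n).NotOnlyOnInputs) (hf : ∀ n, (C n).Computes (f n))
    (hs : PolyBounded fun n => (C n).size)
    (hd : ∃ c : ℕ, ∀ n, (C n).DepthLE (c * (Nat.log 2 n + 1))) :
    ∃ P : (n : ℕ) → HGP n, (∀ n, (P n).IsTHGP) ∧ (∀ n, (P n).Computes (f n)) ∧
      PolyBounded (fun n => (P n).size) ∧ ∀ n, (C n).IsMonotone → (P n).IsMonotone := by
  obtain ⟨c, hc⟩ := (polyBounded_iff_exists_le_two_pow _).1 hs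
  obtain ⟨d, hd⟩ := hd
  choose P h1 h2 h3 h4 using fun n => Circuit.exists_hgp (hC n) (hf n) (hd n) (hc n)
  refine ⟨P, h1, h2, (polyBounded_iff_exists_le_two_pow _).2 ⟨d + 3 * c + 8, fun n =>
    (h3 n).trans (Nat.pow_le_pow_right (by norm_num) ?_)⟩, h4⟩
  rw [add_mul, add_mul, mul_assoc]
  omega

theorem exists_circuits_of_hgps {f : BoolFunSeq} {P : (n : ℕ) → HGP n}
    (hP : ∀ n, (P n).IsTHGP) (hf : ∀ n, (P n).Computes (f n))
    (hs : PolyBounded fun n => (P n).size) :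
    ∃ C : (n : ℕ) → Circuit n, (∀ n, (C n).NotOnlyOnInputs) ∧ (∀ n, (C n).Computes (f n)) ∧
      PolyBounded (fun n => (C n).size) ∧
      (∃ c : ℕ, ∀ n, (C n).DepthLE (c * (Nat.log 2 n + 1))) ∧
      ∀ n, (P n).IsMonotone → (C n).IsMonotone := by
  obtain ⟨c, hc⟩ := (polyBounded_iff_exists_le_two_pow _).1 hs
  choose C h1 h2 h3 h4 h5 using fun n => HGP.exists_circuit (hP n) (hf n) (hc n)
  refine ⟨C, h1, h2, (polyBounded_iff_exists_le_two_pow _).2 ⟨14 * c + 20, fun n =>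
    (h3 n).trans (Nat.pow_le_pow_right (by norm_num) ?_)⟩,
    ⟨12 * c + 19, fun n a k hp => (h4 n a k hp).trans ?_⟩, h5⟩
  all_goals
    rw [add_mul, mul_assoc]
    omega

end TreeHP

theorem theorem6p4 :
    TreeHP.LOGCFLpoly = TreeHP.THGP ∧ TreeHP.mLOGCFLpoly = TreeHP.mTHGP := by
  refine ⟨Set.Subset.antisymm ?_ ?_, Set.Subset.antisymm ?_ ?_⟩
  · rintro f ⟨C, hC, hf, hs, hd⟩
    obtain ⟨P, h1, h2, h3, -⟩ := TreeHP.exists_hgps_of_circuits hC hf hs hd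
    exact ⟨P, h1, h2, h3⟩
  · rintro f ⟨P, hP, hf, hs⟩
    obtain ⟨C, h1, h2, h3, h4, -⟩ := TreeHP.exists_circuits_of_hgps hP hf hs
    exact ⟨C, h1, h2, h3, h4⟩
  · rintro f ⟨C, hC, hf, hs, hd⟩
    obtain ⟨P, h1, h2, h3, h4⟩ :=
      TreeHP.exists_hgps_of_circuits (fun n => (hC n).notOnlyOnInputs) hf hs hd
    exact ⟨P, h1, fun n => h4 n (hC n), h2, h3⟩
  · rintro f ⟨P, hP, hm, hf, hs⟩
    obtain ⟨C, -, h2, h3, h4, h5⟩ := TreeHP.exists_circuits_of_hgps hP hf hs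
    exact ⟨C, fun n => h5 n (hm n), h2, h3, h4⟩
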